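/- All graphs are finite, simple and have at least one vertex. Let $K_r$ and $P_t$ be the complete graph on $r$ vertices and the path on $t$ vertices, and let $K_{1,s}^1$ be the graph obtained from the star $K_{1,s}$ by subdividing each edge exactly once. A graph is $(K_r,K_{1,s}^1,P_t)$-free if none of these three graphs is isomorphic to an induced subgraph of it. A branch decomposition of a graph $G$ is a pair $(T,\delta)$, where $T$ is a finite tree of maximum degree at most $3$ and $\delta$ is a bijection from $V(G)$ to the set of leaves of $T$ (vertices of degree at most $1$, so that the one-vertex tree has one leaf). Every edge $e$ of $T$ induces a partition $(A_e,\overline{A_e})$ of $V(G)$: two vertices are in the same part if and only if $\delta$ maps them to the same component of $T-e$. Let $\mathrm{cutmim}_G(A_e,\overline{A_e})$ be the maximum size of an induced matching in the bipartite graph $G[A_e,\overline{A_e}]$ on the edges of $G$ between $A_e$ and $\overline{A_e}$. The mim-width $\mathrm{mimw}_G(T,\delta)$ is the maximum of $\mathrm{cutmim}_G(A_e,\overline{A_e})$ over all edges $e$ of $T$ ($0$ if $T$ has no edge), and the mim-width of $G$ is the minimum of $\mathrm{mimw}_G(T,\delta)$ over all branch decompositions $(T,\delta)$ of $G$. **Theorem.**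 For all integers $r\ge 1$, $s\ge 1$ and $t\ge 1$, the mim-width of the class of $(K_r,K_{1,s}^1,P_t)$-free graphs is bounded and quickly computable. That is: 1. there is a constant $c$, depending only on $r,s,t$, such that every $(K_r,K_{1,s}^1,P_t)$-free graph has mim-width at most $c$; 2. there are a constant $c'$, an algorithm and a polynomial $p$, depending only on $r,s,t$, such that for every $(K_r,K_{1,s}^1,P_t)$-free graph $G$ on $n$ vertices, given by its adjacency matrix, the algorithm computes in time at most $p(n)$ a branch decomposition $(T,\delta)$ of $G$ with $\mathrm{mimw}_G(T,\delta)\le c'$. -/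

import Mathlib

/-! ### Forbidden induced subgraphs -/

/-- The `1`-subdivision of a graph `H`: every edge `e` of `H` is replaced by a path of length two
through a new vertex (named `e`). -/
def oneSubdivision {V : Type*} (H : SimpleGraph V) : SimpleGraph (V ⊕ H.edgeSet) :=
  SimpleGraph.fromRel fun x y =>
    ∃ (v : V) (e : H.edgeSet), x = Sum.inl v ∧ y = Sum.inr e ∧ v ∈ (e : Sym2 V)

/-- The graph `K_{1,s}^1`: the `1`-subdivision of the star `K_{1,s}`. -/
abbrev subdividedStar (s : ℕ) :
    SimpleGraph ((Fin 1 ⊕ Fin s) ⊕ (completeBipartiteGraph (Fin 1) (Fin s)).edgeSet) :=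
  oneSubdivision (completeBipartiteGraph (Fin 1) (Fin s))

/-- `G` is `(K_r, K_{1,s}^1, P_t)`-free: none of the complete graph on `r` vertices, the
`1`-subdivided star with `s` leaves and the path on `t` vertices is isomorphic to an induced
subgraph of `G`. -/
def IsFreeOf {V : Type*} (r s t : ℕ) (G : SimpleGraph V) : Prop :=
  ¬ (⊤ : SimpleGraph (Fin r)).IsIndContained G ∧
  ¬ (subdividedStar s).IsIndContained G ∧
  ¬ (SimpleGraph.pathGraph t).IsIndContained G

/-! ### Mim-width -/

/-- The size of a maximum induced matching in a graph `H`. -/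
noncomputable def maxInducedMatching {V : Type*} (H : SimpleGraph V) : ℕ∞ :=
  ⨆ (M : H.Subgraph) (_ : M.IsMatching ∧ M.IsInduced), M.edgeSet.encard

/-- `cutmim_G(A, B)`: the size of a maximum induced matching in the bipartite subgraph `G[A, B]`
of `G` whose edges are the edges of `G` between `A` and `B`. -/
noncomputable def cutmim {V : Type*} (G : SimpleGraph V) (A B : Set V) : ℕ∞ :=
  maxInducedMatching (G.between A B)

/-- A branch decomposition of (a graph with vertex set) `V`: a subcubic tree together with a
bijection from `V` to the leaves of the tree. The vertex set of the tree is taken to be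
`{0, …, size - 1}`. A leaf is a vertex of degree at most one (degree zero occurs only in
the one-vertex tree, whose only vertex counts as a leaf). -/
structure BranchDecomposition (V : Type*) where
  /-- the number of vertices of the tree -/
  size : ℕ
  /-- the tree -/
  tree : SimpleGraph (Fin size)
  isTree : tree.IsTree
  subcubic : ∀ x, (tree.neighborSet x).ncard ≤ 3
  /-- the bijection from `V` to the leaves -/
  leaf : V ≃ {x : Fin size // (tree.neighborSet x).ncard ≤ 1}

namespace BranchDecomposition

/-- For an edge `xy` of the tree: the set of all `v` whose leaf lies in the component of
`T - xy` that contains `x`. -/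
def side {V : Type*} (D : BranchDecomposition V) (x y : Fin D.size) : Set V :=
  {v | (D.tree.deleteEdges {s(x, y)}).Reachable x (D.leaf v)}

/-- `mimw_G(T, δ)`: the maximum of `cutmim_G(A_e, V ∖ A_e)` over the edges `e` of the tree. -/
noncomputable def mimw {V : Type*} (D : BranchDecomposition V) (G : SimpleGraph V) : ℕ∞ :=
  ⨆ (x : Fin D.size) (y : Fin D.size) (_ : D.tree.Adj x y),
    cutmim G (D.side x y) (D.side x y)ᶜ

end BranchDecomposition

/-- The mim-width of `G`: the minimum of `mimw_G(T, δ)` over all branch decompositions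
(it would be `⊤` if there were no branch decomposition). -/
noncomputable def mimWidth {V : Type*} (G : SimpleGraph V) : ℕ∞ :=
  ⨅ D : BranchDecomposition V, D.mimw G

/-! ### Random access machines with structured control flow

A machine has registers and arrays, both indexed by natural numbers; registers and array cells
hold natural numbers. Each elementary instruction and each test takes one time unit. A program
mentions only finitely many registers and arrays by name, but array cells are addressed
indirectly, through registers. There is addition and truncated subtraction but no multiplication,
so the number of bits of the contents grows by at most one per time unit; hence running times on
this machine and on Turing machines are polynomially related. -/

namespace RAM

/-- The contents of the registers and of the arrays. -/
structure State where
  reg : ℕ → ℕ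
  arr : ℕ → ℕ → ℕ

/-- Programs. -/
inductive Program where
  /-- do nothing -/
  | skip : Program
  /-- `x := c` for a constant `c` -/
  | const (x c : ℕ) : Program
  /-- `x := y + z` -/
  | add (x y z : ℕ) : Program
  /-- `x := max (y - z) 0` -/
  | sub (x y z : ℕ) : Program
  /-- `x := a[i]`, for an array `a` and a register `i` -/
  | load (x a i : ℕ) : Program
  /-- `a[i] := x`, for an array `a` and registers `i`, `x` -/
  | store (a i x : ℕ) : Program
  /-- first `P`, then `Q` -/
  | seq (P Q : Program) : Program
  /-- if `x < y` then `P` else `Q` -/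
  | ifLt (x y : ℕ) (P Q : Program) : Program
  /-- while `x < y` do `P` -/
  | whileLt (x y : ℕ) (P : Program) : Program

/-- Set register `x` to `c`. -/
def State.setReg (σ : State) (x c : ℕ) : State :=
  { σ with reg := Function.update σ.reg x c }

/-- Set cell `i` of array `a` to `c`. -/
def State.setCell (σ : State) (a i c : ℕ) : State :=
  { σ with arr := Function.update σ.arr a (Function.update (σ.arr a) i c) }

/-- `Runs P σ τ k`: started in `σ`, the program `P` halts in `τ` after exactly `k` time units. -/
inductive Runs : Program → State → State → ℕ → Prop where
  | skip (σ : State) : Runs .skip σ σ 1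
  | const (σ : State) (x c : ℕ) : Runs (.const x c) σ (σ.setReg x c) 1
  | add (σ : State) (x y z : ℕ) : Runs (.add x y z) σ (σ.setReg x (σ.reg y + σ.reg z)) 1
  | sub (σ : State) (x y z : ℕ) : Runs (.sub x y z) σ (σ.setReg x (σ.reg y - σ.reg z)) 1
  | load (σ : State) (x a i : ℕ) : Runs (.load x a i) σ (σ.setReg x (σ.arr a (σ.reg i))) 1
  | store (σ : State) (a i x : ℕ) : Runs (.store a i x) σ (σ.setCell a (σ.reg i) (σ.reg x)) 1
  | seq {P Q : Program} {σ τ υ : State} {k l : ℕ} (hP : Runs P σ τ k) (hQ : Runs Q τ υ l) :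
      Runs (.seq P Q) σ υ (k + l)
  | ifTrue {x y : ℕ} {P Q : Program} {σ τ : State} {k : ℕ} (h : σ.reg x < σ.reg y)
      (hP : Runs P σ τ k) : Runs (.ifLt x y P Q) σ τ (k + 1)
  | ifFalse {x y : ℕ} {P Q : Program} {σ τ : State} {k : ℕ} (h : ¬ σ.reg x < σ.reg y)
      (hQ : Runs Q σ τ k) : Runs (.ifLt x y P Q) σ τ (k + 1)
  | whileTrue {x y : ℕ} {P : Program} {σ τ υ : State} {k l : ℕ} (h : σ.reg x < σ.reg y)
      (hP : Runs P σ τ k) (hW : Runs (.whileLt x y P) τ υ l) :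
      Runs (.whileLt x y P) σ υ (k + l + 1)
  | whileFalse {x y : ℕ} {P : Program} {σ : State} (h : ¬ σ.reg x < σ.reg y) :
      Runs (.whileLt x y P) σ σ 1

open Classical in
/-- The initial state for the input graph `G` on `{0, …, n - 1}`: register `0` holds `n`, array
`0` holds the adjacency matrix of `G` row by row, and everything else is zero. -/
noncomputable def inputState {n : ℕ} (G : SimpleGraph (Fin n)) : State where
  reg := fun x => if x = 0 then n else 0
  arr := fun a p => if a = 0 ∧ ∃ i j : Fin n, p = i * n + j ∧ G.Adj i j then 1 else 0

open Classical in
/-- The state `τ` describes the branch decomposition `D` of `{0, …, n - 1}`: register `1` holds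
the number `m` of vertices of the tree, array `1` holds the adjacency matrix of the tree row by
row, and array `2` holds the list of the leaves assigned to `0, …, n - 1`. -/
def Outputs {n : ℕ} (τ : State) (D : BranchDecomposition (Fin n)) : Prop :=
  τ.reg 1 = D.size ∧
  (∀ i j : Fin D.size, τ.arr 1 (i * D.size + j) = if D.tree.Adj i j then 1 else 0) ∧
  ∀ v : Fin n, τ.arr 2 v = ((D.leaf v : Fin D.size) : ℕ)

end RAM

universe u

/-! ### Bounded and quickly computable mim-width -/

/-- The class `C` of graphs has bounded mim-width: there is a constant `c` such that every (finite,
nonempty) graph in `C` has mim-width at most `c`. -/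
def BoundedMimWidth (C : ∀ ⦃V : Type u⦄, SimpleGraph V → Prop) : Prop :=
  ∃ c : ℕ, ∀ (V : Type u) [Finite V] [Nonempty V] (G : SimpleGraph V), C G → mimWidth G ≤ c

/-- The mim-width of the class `C` of graphs is quickly computable: there are a constant `c` and
a polynomial-time algorithm that computes, for every (finite, nonempty) graph in `C`, a branch
decomposition whose mim-width is at most `c`. -/
def QuicklyComputableMimWidth (C : ∀ ⦃V : Type⦄, SimpleGraph V → Prop) : Prop :=
  ∃ (c : ℕ) (P : RAM.Program) (p : Polynomial ℕ),
    ∀ (n : ℕ) (G : SimpleGraph (Fin n)), 1 ≤ n → C G →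
      ∃ (τ : RAM.State) (k : ℕ) (D : BranchDecomposition (Fin n)),
        RAM.Runs P (RAM.inputState G) τ k ∧ k ≤ p.eval n ∧ RAM.Outputs τ D ∧ D.mimw G ≤ c

/-! Construct a linear order of the vertices all of whose prefixes cut only bounded induced
matchings, and hang the vertices in this order on a caterpillar. The order comes from repeated
refinement. At first all vertices form one cell with an arbitrary pivot. In each step, every cell is
split into neighbours and non-neighbours of its pivot and then into connected components; the keys
record the resulting ordered partitions. A new cell inside an old cell with pivot `p` gets as its
pivot a vertex of the old cell that is adjacent to `p` and has a neighbour in the new cell; if there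
is none, a vertex of the new cell itself is taken.

The process ends quickly (`IsRefinement.injective`). As long as the cell of `w` is not a singleton,
consecutive pivots along its history are adjacent. Since later pivots lie in cells that are
homogeneous to an earlier pivot, each pivot is adjacent either to all later pivots or only to the
next one. Among `r * t` pivots there are either `t` consecutive ones of the second kind, an induced
path, or `r` of the first kind, a clique. So after `r * t + 1` steps all cells are singletons.

The cuts are small (`IsRefinement.exists_cut_bound`). An edge crossing a cut of the final order has
its ends in a common cell up to some level, and then only the pivot can separate them: it sees
exactly one end. Matching edges separated at the same level come from the same cell, since cells are
intervals of the order. If many of them have, say, their left end adjacent to this common pivot,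
then two applications of Ramsey's theorem make the left ends and the right ends independent, and an
induced subdivided star appears.

The number of steps depends only on `r` and `t`, and a step consists of nested loops of length `n`.
It is written in a small loop language whose compiler comes with a proof of correctness and a
polynomial time bound, so that the algorithm itself is analysed only through its effect on arrays.
The first part of the theorem follows from the same orders after numbering the vertices. -/

/-! ### A small language of bounded loops, compiled to the random access machine -/

namespace RAM

/-- `P`, started in `σ`, halts within `b` time units in a state that satisfies `Q`. -/
def HaltsWithin (P : Program) (σ : State) (b : ℕ) (Q : State → Prop) : Prop :=
  ∃ τ k, Runs P σ τ k ∧ k ≤ b ∧ Q τ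

theorem HaltsWithin.mono {P : Program} {σ : State} {b b' : ℕ} {Q Q' : State → Prop}
    (h : HaltsWithin P σ b Q) (hb : b ≤ b') (hQ : ∀ τ, Q τ → Q' τ) : HaltsWithin P σ b' Q' := by
  obtain ⟨τ, k, hr, hk, hq⟩ := h
  exact ⟨τ, k, hr, hk.trans hb, hQ _ hq⟩

theorem HaltsWithin.seq {P P' : Program} {σ : State} {b b' : ℕ} {Q Q' : State → Prop}
    (h : HaltsWithin P σ b Q) (h' : ∀ τ, Q τ → HaltsWithin P' τ b' Q') :
    HaltsWithin (.seq P P') σ (b + b') Q' := by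
  obtain ⟨τ, k, hr, hk, hq⟩ := h
  obtain ⟨υ, l, hr', hl, hq'⟩ := h' τ hq
  exact ⟨υ, _, hr.seq hr', by omega, hq'⟩

theorem HaltsWithin.ifLt {x y : ℕ} {P P' : Program} {σ : State} {b : ℕ} {Q : State → Prop}
    (h : σ.reg x < σ.reg y → HaltsWithin P σ b Q)
    (h' : ¬ σ.reg x < σ.reg y → HaltsWithin P' σ b Q) :
    HaltsWithin (.ifLt x y P P') σ (b + 1) Q := by
  by_cases hxy : σ.reg x < σ.reg y
  · obtain ⟨τ, k, hr, hk, hq⟩ := h hxy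
    exact ⟨τ, _, .ifTrue hxy hr, by omega, hq⟩
  · obtain ⟨τ, k, hr, hk, hq⟩ := h' hxy
    exact ⟨τ, _, .ifFalse hxy hr, by omega, hq⟩

/-- The rule for a loop whose counter `x` runs up to the content `N` of the register `y`. -/
theorem HaltsWithin.whileLt {x y N : ℕ} {P : Program} {b : ℕ} (Inv : ℕ → State → Prop)
    (hstep : ∀ j σ, j < N → Inv j σ → HaltsWithin P σ b (Inv (j + 1)))
    (hreg : ∀ j σ, Inv j σ → σ.reg x = j ∧ σ.reg y = N) {σ : State} (h : Inv 0 σ) :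
    HaltsWithin (.whileLt x y P) σ (N * (b + 1) + 1) (Inv N) := by
  suffices H : ∀ m j σ, j + m = N → Inv j σ →
      HaltsWithin (.whileLt x y P) σ (m * (b + 1) + 1) (Inv N) from H N 0 σ (by omega) h
  intro m
  induction m with
  | zero =>
    intro j σ hj hI
    obtain ⟨hx, hy⟩ := hreg j σ hI
    obtain rfl : j = N := by omega
    exact ⟨σ, 1, .whileFalse (by omega), by omega, hI⟩
  | succ m ih =>
    intro j σ hj hI
    obtain ⟨hx, hy⟩ := hreg j σ hI
    obtain ⟨τ, k, hr, hk, hq⟩ := hstep j σ (by omega) hI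
    obtain ⟨υ, l, hr', hl, hq'⟩ := ih (j + 1) τ (by omega) hq
    refine ⟨υ, _, .whileTrue (by omega) hr hr', ?_, hq'⟩
    rw [add_mul]
    omega

/-- Expressions over registers, arrays and the input size (the content of register `0`). -/
inductive Expr where
  | var (x : ℕ) : Expr
  | lit (c : ℕ) : Expr
  | add (e f : Expr) : Expr
  | sub (e f : Expr) : Expr
  /-- multiplication by the input size -/
  | mulSize (e : Expr) : Expr
  | get (a : ℕ) (e : Expr) : Expr

namespace Expr

/-- The value of an expression for the registers `ρ` and the arrays `A`. -/
def eval (ρ : ℕ → ℕ) (A : ℕ → ℕ → ℕ) : Expr → ℕ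
  | var x => ρ x
  | lit c => c
  | add e f => e.eval ρ A + f.eval ρ A
  | sub e f => e.eval ρ A - f.eval ρ A
  | mulSize e => e.eval ρ A * ρ 0
  | get a e => A a (e.eval ρ A)

/-- All registers that occur in the expression are below `d`. -/
def Scoped (d : ℕ) : Expr → Prop
  | var x => x < d
  | lit _ => True
  | add e f => e.Scoped d ∧ f.Scoped d
  | sub e f => e.Scoped d ∧ f.Scoped d
  | mulSize e => e.Scoped d
  | get _ e => e.Scoped d

theorem Scoped.mono {d d' : ℕ} (hd : d ≤ d') : ∀ {e : Expr}, e.Scoped d → e.Scoped d'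
  | var _, h => lt_of_lt_of_le (show _ < _ from h) hd
  | lit _, _ => trivial
  | add _ _, h => ⟨h.1.mono hd, h.2.mono hd⟩
  | sub _ _, h => ⟨h.1.mono hd, h.2.mono hd⟩
  | mulSize e, h => Scoped.mono (e := e) hd h
  | get _ e, h => Scoped.mono (e := e) hd h

/-- A program that puts the value of the expression into register `d` and changes no register
below `d`. -/
def compile : Expr → ℕ → Program
  | var x, d => .seq (.const d 0) (.add d d x)
  | lit c, d => .const d c
  | add e f, d => .seq (e.compile d) (.seq (f.compile (d + 1)) (.add d d (d + 1)))
  | sub e f, d => .seq (e.compile d) (.seq (f.compile (d + 1)) (.sub d d (d + 1)))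
  | mulSize e, d =>
    .seq (e.compile d) <| .seq (.const (d + 1) 0) <| .seq (.const (d + 2) 0) <|
      .seq (.const (d + 3) 1) <|
      .seq (.whileLt (d + 2) 0
        (.seq (.add (d + 1) (d + 1) d) (.add (d + 2) (d + 2) (d + 3)))) <|
      .seq (.const d 0) (.add d d (d + 1))
  | get a e, d => .seq (e.compile d) (.load d a d)

/-- A bound on the running time of the compiled expression, in terms of the input size. -/
noncomputable def cost : Expr → Polynomial ℕ
  | var _ => 2
  | lit _ => 1
  | add e f => e.cost + (f.cost + 1)
  | sub e f => e.cost + (f.cost + 1)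
  | mulSize e => e.cost + (1 + (1 + (1 + ((Polynomial.X * 3 + 1) + (1 + 1)))))
  | get _ e => e.cost + 1

end Expr

theorem HaltsWithin.const {x c : ℕ} {σ : State} {Q : State → Prop} (h : Q (σ.setReg x c)) :
    HaltsWithin (.const x c) σ 1 Q := ⟨_, _, .const σ x c, le_rfl, h⟩

theorem HaltsWithin.add {x y z : ℕ} {σ : State} {Q : State → Prop}
    (h : Q (σ.setReg x (σ.reg y + σ.reg z))) : HaltsWithin (.add x y z) σ 1 Q :=
  ⟨_, _, .add σ x y z, le_rfl, h⟩

theorem HaltsWithin.sub {x y z : ℕ} {σ : State} {Q : State → Prop}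
    (h : Q (σ.setReg x (σ.reg y - σ.reg z))) : HaltsWithin (.sub x y z) σ 1 Q :=
  ⟨_, _, .sub σ x y z, le_rfl, h⟩

theorem HaltsWithin.load {x a i : ℕ} {σ : State} {Q : State → Prop}
    (h : Q (σ.setReg x (σ.arr a (σ.reg i)))) : HaltsWithin (.load x a i) σ 1 Q :=
  ⟨_, _, .load σ x a i, le_rfl, h⟩

theorem HaltsWithin.store {x a i : ℕ} {σ : State} {Q : State → Prop}
    (h : Q (σ.setCell a (σ.reg i) (σ.reg x))) : HaltsWithin (.store a i x) σ 1 Q :=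
  ⟨_, _, .store σ a i x, le_rfl, h⟩

theorem HaltsWithin.skip {σ : State} {Q : State → Prop} (h : Q σ) :
    HaltsWithin .skip σ 1 Q := ⟨_, _, .skip σ, le_rfl, h⟩

@[simp] theorem State.setReg_arr (σ : State) (x c : ℕ) : (σ.setReg x c).arr = σ.arr := rfl

theorem State.setReg_reg (σ : State) (x c y : ℕ) :
    (σ.setReg x c).reg y = if y = x then c else σ.reg y := by
  simp [State.setReg, Function.update_apply]


theorem Expr.eval_congr {d : ℕ} {ρ ρ' : ℕ → ℕ} (A : ℕ → ℕ → ℕ) (hd : 0 < d)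
    (h : ∀ x < d, ρ x = ρ' x) (e : Expr) (he : e.Scoped d) : e.eval ρ A = e.eval ρ' A := by
  induction e with
  | var x => exact h x he
  | lit c => rfl
  | add e f ihe ihf => simp only [eval, ihe he.1, ihf he.2]
  | sub e f ihe ihf => simp only [eval, ihe he.1, ihf he.2]
  | mulSize e ihe => simp only [eval, ihe he, h 0 hd]
  | get a e ihe => simp only [eval, ihe he]

/-- The states `σ` and `τ` have the same arrays and the same registers below `d`. -/
def AgreeBelow (d : ℕ) (σ τ : State) : Prop := τ.arr = σ.arr ∧ ∀ x < d, τ.reg x = σ.reg x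

theorem AgreeBelow.refl (d : ℕ) (σ : State) : AgreeBelow d σ σ := ⟨rfl, fun _ _ => rfl⟩

theorem AgreeBelow.trans {d d' : ℕ} {σ τ υ : State} (h : AgreeBelow d σ τ)
    (h' : AgreeBelow d' τ υ) (hd : d ≤ d') : AgreeBelow d σ υ :=
  ⟨h'.1.trans h.1, fun x hx => (h'.2 x (hx.trans_le hd)).trans (h.2 x hx)⟩

theorem AgreeBelow.setReg {d x c : ℕ} {σ τ : State} (h : AgreeBelow d σ τ) (hx : d ≤ x) :
    AgreeBelow d σ (τ.setReg x c) :=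
  ⟨h.1, fun y hy => by rw [State.setReg_reg, if_neg (by omega), h.2 y hy]⟩

theorem AgreeBelow.eval_eq {d : ℕ} {σ τ : State} (h : AgreeBelow d σ τ) (hd : 0 < d) {e : Expr}
    (he : e.Scoped d) : e.eval τ.reg τ.arr = e.eval σ.reg σ.arr := by
  rw [h.1]
  exact e.eval_congr _ hd h.2 he

/-- Registers from `d` upwards are scratch space. A second operand is evaluated from `d + 1` on, so
it cannot destroy the first. Multiplication by the input size is repeated addition, with the loop
counter in `d + 2` and the constant one in `d + 3`. -/
theorem Expr.compile_spec (e : Expr) : ∀ {d : ℕ} (σ : State), 0 < d → e.Scoped d →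
    HaltsWithin (e.compile d) σ (e.cost.eval (σ.reg 0)) fun τ =>
      AgreeBelow d σ τ ∧ τ.reg d = e.eval σ.reg σ.arr := by
  induction e with
  | var x =>
    intro d σ _ hs
    have hx : x < d := hs
    simp only [cost, Polynomial.eval_ofNat]
    refine HaltsWithin.seq (b := 1) (b' := 1) (.const rfl) ?_
    rintro τ rfl
    refine .add ⟨((AgreeBelow.refl d σ).setReg le_rfl).setReg le_rfl, ?_⟩
    simp [State.setReg_reg, hx.ne, eval]
  | lit c =>
    intro d σ _ _
    simp only [cost, Polynomial.eval_one]
    exact .const ⟨(AgreeBelow.refl d σ).setReg le_rfl, by simp [State.setReg_reg, eval]⟩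
  | add e f ihe ihf =>
    intro d σ hd hs
    simp only [cost, Polynomial.eval_add, Polynomial.eval_one]
    refine (ihe σ hd hs.1).seq ?_
    rintro τ ⟨hτ, hv⟩
    rw [← hτ.2 0 hd]
    refine (ihf τ d.succ_pos (hs.2.mono d.le_succ)).seq ?_
    rintro υ ⟨hυ, hw⟩
    refine .add ⟨(hτ.trans hυ d.le_succ).setReg le_rfl, ?_⟩
    simp [State.setReg_reg, eval, hw, hυ.2 d d.lt_succ_self, hv, hτ.eval_eq hd hs.2]
  | sub e f ihe ihf =>
    intro d σ hd hs
    simp only [cost, Polynomial.eval_add, Polynomial.eval_one]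
    refine (ihe σ hd hs.1).seq ?_
    rintro τ ⟨hτ, hv⟩
    rw [← hτ.2 0 hd]
    refine (ihf τ d.succ_pos (hs.2.mono d.le_succ)).seq ?_
    rintro υ ⟨hυ, hw⟩
    refine .sub ⟨(hτ.trans hυ d.le_succ).setReg le_rfl, ?_⟩
    simp [State.setReg_reg, eval, hw, hυ.2 d d.lt_succ_self, hv, hτ.eval_eq hd hs.2]
  | mulSize e ihe =>
    intro d σ hd hs
    simp only [cost, Polynomial.eval_add, Polynomial.eval_one, Polynomial.eval_mul,
      Polynomial.eval_X, Polynomial.eval_ofNat]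
    refine (ihe σ hd hs).seq ?_
    rintro τ ⟨hτ, hv⟩
    refine HaltsWithin.seq (.const rfl) ?_
    rintro τ₁ rfl
    refine HaltsWithin.seq (.const rfl) ?_
    rintro τ₂ rfl
    refine HaltsWithin.seq (.const rfl) ?_
    rintro τ₃ rfl
    refine HaltsWithin.seq (Q := fun υ => AgreeBelow d σ υ ∧ υ.reg (d + 1) =
      σ.reg 0 * e.eval σ.reg σ.arr) ?_ ?_
    · refine (HaltsWithin.whileLt (b := 2) (N := σ.reg 0) (fun j υ => AgreeBelow d σ υ ∧
        υ.reg d = e.eval σ.reg σ.arr ∧ υ.reg (d + 1) = j * e.eval σ.reg σ.arr ∧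
        υ.reg (d + 2) = j ∧ υ.reg (d + 3) = 1) ?_ ?_ ?_).mono le_rfl fun υ h => ⟨h.1, h.2.2.1⟩
      · rintro j υ hj ⟨h1, h2, h3, h4, h5⟩
        refine HaltsWithin.seq (b := 1) (b' := 1) (.add rfl) ?_
        rintro τ₄ rfl
        refine .add ⟨(h1.setReg (by omega)).setReg (by omega), ?_⟩
        simp [State.setReg_reg, h2, h3, h4, h5, add_mul]
      · rintro j υ ⟨h1, h2, h3, h4, h5⟩
        exact ⟨h4, h1.2 0 hd⟩
      · refine ⟨((hτ.setReg (by omega)).setReg (by omega)).setReg (by omega), ?_⟩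
        simp [State.setReg_reg, hv]
    · rintro υ ⟨h1, h2⟩
      refine HaltsWithin.seq (.const rfl) ?_
      rintro τ₃ rfl
      refine .add ⟨(h1.setReg le_rfl).setReg le_rfl, ?_⟩
      simp [State.setReg_reg, h2, eval, mul_comm]
  | get a e ihe =>
    intro d σ hd hs
    simp only [cost, Polynomial.eval_add, Polynomial.eval_one]
    refine (ihe σ hd hs).seq ?_
    rintro τ ⟨hτ, hv⟩
    refine .load ⟨hτ.setReg le_rfl, ?_⟩
    simp [State.setReg_reg, hv, eval, hτ.1]

/-! ### Statements: semantics, compilation and running time -/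

/-- Statements. Variables are numbered by nesting depth: a statement in the scope of the variables
`0, …, d - 1` that binds a variable binds the variable `d`. -/
inductive Stmt where
  | skip : Stmt
  /-- `a[e] := f` -/
  | store (a : ℕ) (e f : Expr) : Stmt
  | seq (S S' : Stmt) : Stmt
  /-- execute `S` if `e` is positive -/
  | ifPos (e : Expr) (S : Stmt) : Stmt
  /-- execute `S` with the next variable bound to the value of `e` -/
  | bind (e : Expr) (S : Stmt) : Stmt
  /-- execute `S` for all values of the next variable below the input size -/
  | forAll (S : Stmt) : Stmt

namespace Stmt

/-- The effect of a statement on the arrays. -/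
def sem : Stmt → ℕ → (ℕ → ℕ) → (ℕ → ℕ → ℕ) → ℕ → ℕ → ℕ
  | skip, _, _, A => A
  | store a e f, _, ρ, A =>
    Function.update A a (Function.update (A a) (e.eval ρ A) (f.eval ρ A))
  | seq S S', d, ρ, A => S'.sem d ρ (S.sem d ρ A)
  | ifPos e S, d, ρ, A => if 0 < e.eval ρ A then S.sem d ρ A else A
  | bind e S, d, ρ, A => S.sem (d + 1) (Function.update ρ d (e.eval ρ A)) A
  | forAll S, d, ρ, A =>
    Nat.rec A (fun i B => S.sem (d + 1) (Function.update ρ d i) B) (ρ 0)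

/-- All variables of the statement are in scope, if `0, …, d - 1` are. -/
def Scoped : ℕ → Stmt → Prop
  | _, skip => True
  | d, store _ e f => e.Scoped d ∧ f.Scoped d
  | d, seq S S' => S.Scoped d ∧ S'.Scoped d
  | d, ifPos e S => e.Scoped d ∧ S.Scoped d
  | d, bind e S => e.Scoped d ∧ S.Scoped (d + 1)
  | d, forAll S => S.Scoped (d + 1)

/-- A program that has the effect of the statement on the arrays and changes no register below
`d`, where the register `x` holds the value of the variable `x`. -/
def compile : Stmt → ℕ → Program
  | skip, _ => .skip
  | store a e f, d => .seq (e.compile d) (.seq (f.compile (d + 1)) (.store a d (d + 1)))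
  | seq S S', d => .seq (S.compile d) (S'.compile d)
  | ifPos e S, d => .seq (e.compile d) (.seq (.const (d + 1) 0)
      (.ifLt (d + 1) d (S.compile d) .skip))
  | bind e S, d => .seq (e.compile d) (S.compile (d + 1))
  | forAll S, d => .seq (.const d 0) (.whileLt d 0
      (.seq (S.compile (d + 1)) (.seq (.const (d + 1) 1) (.add d d (d + 1)))))

/-- A bound on the running time of the compiled statement, in terms of the input size. -/
noncomputable def cost : Stmt → Polynomial ℕ
  | skip => 1
  | store _ e f => e.cost + (f.cost + 1)
  | seq S S' => S.cost + S'.cost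
  | ifPos e S => e.cost + (1 + (S.cost + 1 + 1))
  | bind e S => e.cost + S.cost
  | forAll S => 1 + (Polynomial.X * (S.cost + (1 + 1) + 1) + 1)

/-- The statement does not write to the array `a`. -/
def Keeps (a : ℕ) : Stmt → Prop
  | skip => True
  | store b _ _ => a ≠ b
  | seq S S' => S.Keeps a ∧ S'.Keeps a
  | ifPos _ S => S.Keeps a
  | bind _ S => S.Keeps a
  | forAll S => S.Keeps a

theorem Keeps.sem_eq {a : ℕ} {S : Stmt} (h : S.Keeps a) (d : ℕ) (ρ : ℕ → ℕ) (A : ℕ → ℕ → ℕ) :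
    S.sem d ρ A a = A a := by
  induction S generalizing d ρ A with
  | skip => rfl
  | store b e f => exact Function.update_of_ne h _ _
  | seq S S' ih ih' => exact (ih' h.2 _ _ _).trans (ih h.1 _ _ _)
  | ifPos e S ih =>
    simp only [sem]
    split
    · exact ih h _ _ _
    · rfl
  | bind e S ih => exact ih h _ _ _
  | forAll S ih =>
    simp only [sem]
    generalize ρ 0 = n
    induction n with
    | zero => rfl
    | succ n ihn => exact (ih h _ _ _).trans ihn

/-- Rule for the semantics of loops. -/
theorem sem_forAll {S : Stmt} {d : ℕ} {ρ : ℕ → ℕ} {A : ℕ → ℕ → ℕ}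
    (Inv : ℕ → (ℕ → ℕ → ℕ) → Prop) (h0 : Inv 0 A)
    (hstep : ∀ i B, i < ρ 0 → Inv i B → Inv (i + 1) (S.sem (d + 1) (Function.update ρ d i) B)) :
    Inv (ρ 0) ((forAll S).sem d ρ A) := by
  simp only [sem]
  suffices H : ∀ n ≤ ρ 0,
      Inv n (Nat.rec A (fun i B => S.sem (d + 1) (Function.update ρ d i) B) n) from H _ le_rfl
  intro n
  induction n with
  | zero => exact fun _ => h0
  | succ n ih => exact fun hn => hstep n _ hn (ih (by omega))

/-- Every loop runs exactly as often as register `0` says, and compiled code never changes that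
register; hence the time bound is a polynomial that can be read off the syntax. Later arguments
about programs need only `sem`. -/
theorem compile_spec (S : Stmt) : ∀ {d : ℕ} {ρ : ℕ → ℕ} (σ : State), 0 < d → S.Scoped d →
    (∀ x < d, σ.reg x = ρ x) → HaltsWithin (S.compile d) σ (S.cost.eval (ρ 0)) fun τ =>
      τ.arr = S.sem d ρ σ.arr ∧ ∀ x < d, τ.reg x = ρ x := by
  induction S with
  | skip =>
    intro d ρ σ hd _ hσ
    simp only [cost, Polynomial.eval_one]
    exact .skip ⟨rfl, hσ⟩
  | store a e f =>
    intro d ρ σ hd hs hσ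
    simp only [cost, Polynomial.eval_add, Polynomial.eval_one]
    rw [← hσ 0 hd]
    refine (e.compile_spec σ hd hs.1).seq ?_
    rintro τ ⟨hτ, hv⟩
    rw [← hτ.2 0 hd]
    refine (f.compile_spec τ d.succ_pos (hs.2.mono d.le_succ)).seq ?_
    rintro υ ⟨hυ, hw⟩
    refine .store ⟨?_, fun x hx => ((hτ.trans hυ d.le_succ).2 x hx).trans (hσ x hx)⟩
    simp only [State.setCell, sem]
    rw [hw, hυ.2 d d.lt_succ_self, hv, hυ.1, hτ.1, ← hτ.1, hτ.eval_eq hd hs.2,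
      e.eval_congr _ hd hσ hs.1, f.eval_congr _ hd hσ hs.2, hτ.1]
  | seq S S' ih ih' =>
    intro d ρ σ hd hs hσ
    simp only [cost, Polynomial.eval_add]
    refine (ih σ hd hs.1 hσ).seq ?_
    rintro τ ⟨hA, hτ⟩
    refine (ih' τ hd hs.2 hτ).mono le_rfl ?_
    rintro υ ⟨hB, hυ⟩
    exact ⟨by rw [hB, hA]; rfl, hυ⟩
  | ifPos e S ih =>
    intro d ρ σ hd hs hσ
    simp only [cost, Polynomial.eval_add, Polynomial.eval_one]
    nth_rw 1 [← hσ 0 hd]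
    refine (e.compile_spec σ hd hs.1).seq ?_
    rintro τ ⟨hτ, hv⟩
    refine HaltsWithin.seq (.const rfl) ?_
    rintro τ₁ rfl
    have hτ' : ∀ x < d, (τ.setReg (d + 1) 0).reg x = ρ x := fun x hx =>
      ((hτ.setReg (by omega)).2 x hx).trans (hσ x hx)
    have hc : ((τ.setReg (d + 1) 0).reg (d + 1) < (τ.setReg (d + 1) 0).reg d) ↔
        0 < e.eval ρ σ.arr := by
      simp [State.setReg_reg, hv, e.eval_congr _ hd hσ hs.1]
    refine .ifLt (fun h => ?_) (fun h => ?_)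
    · refine (ih _ hd hs.2 hτ').mono (by omega) ?_
      rintro υ ⟨hB, hυ⟩
      refine ⟨?_, hυ⟩
      rw [hB, State.setReg_arr, hτ.1]
      exact (if_pos (hc.1 h)).symm
    · refine HaltsWithin.mono (.skip (Q := fun υ => υ.arr = (ifPos e S).sem d ρ σ.arr ∧
        ∀ x < d, υ.reg x = ρ x) ⟨?_, hτ'⟩) (by omega) fun _ h => h
      rw [State.setReg_arr, hτ.1]
      exact (if_neg (mt hc.2 h)).symm
  | bind e S ih =>
    intro d ρ σ hd hs hσ
    simp only [cost, Polynomial.eval_add]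
    nth_rw 1 [← hσ 0 hd]
    refine (e.compile_spec σ hd hs.1).seq ?_
    rintro τ ⟨hτ, hv⟩
    have key := ih (ρ := Function.update ρ d (e.eval ρ σ.arr)) τ d.succ_pos hs.2 ?_
    · rw [Function.update_of_ne hd.ne] at key
      refine key.mono le_rfl ?_
      rintro υ ⟨hB, hυ⟩
      refine ⟨by rw [hB, hτ.1]; rfl, fun x hx => ?_⟩
      rw [hυ x (by omega), Function.update_of_ne hx.ne]
    · intro x hx
      rcases Nat.lt_succ_iff_lt_or_eq.1 hx with hx | rfl
      · rw [Function.update_of_ne hx.ne, hτ.2 x hx, hσ x hx]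
      · rw [Function.update_self, hv, e.eval_congr _ hd hσ hs.1]
  | forAll S ih =>
    intro d ρ σ hd hs hσ
    simp only [cost, Polynomial.eval_add, Polynomial.eval_one, Polynomial.eval_mul,
      Polynomial.eval_X]
    refine HaltsWithin.seq (.const rfl) ?_
    rintro τ rfl
    refine (HaltsWithin.whileLt (N := ρ 0) (fun j υ =>
      (υ.arr = Nat.rec σ.arr (fun i B => S.sem (d + 1) (Function.update ρ d i) B) j ∧
        ∀ x < d, υ.reg x = ρ x) ∧ υ.reg d = j) ?_ ?_ ?_).mono le_rfl fun υ h => h.1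
    · rintro j υ hj ⟨⟨hA, hr⟩, hj'⟩
      have key := ih (ρ := Function.update ρ d j) υ d.succ_pos hs ?_
      · rw [Function.update_of_ne hd.ne] at key
        refine key.seq ?_
        rintro υ' ⟨hA', hr'⟩
        refine HaltsWithin.seq (.const rfl) ?_
        rintro τ rfl
        refine .add ⟨⟨?_, fun x hx => ?_⟩, ?_⟩
        · simp only [State.setReg_arr, hA', hA]
        · rw [State.setReg_reg, if_neg hx.ne, State.setReg_reg, if_neg (by omega),
            hr' x (by omega), Function.update_of_ne hx.ne]
        · simp [State.setReg_reg, hr' d d.lt_succ_self]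
      · intro x hx
        rcases Nat.lt_succ_iff_lt_or_eq.1 hx with hx | rfl
        · rw [Function.update_of_ne hx.ne, hr x hx]
        · rw [Function.update_self, hj']
    · rintro j υ ⟨⟨hA, hr⟩, hj'⟩
      exact ⟨hj', hr 0 hd⟩
    · refine ⟨⟨rfl, fun x hx => ?_⟩, ?_⟩
      · rw [State.setReg_reg, if_neg hx.ne, hσ x hx]
      · simp [State.setReg_reg]

end Stmt

end RAM

/-! ### Refinement sequences -/

/-- `u` links the cell of `x` (for the key `K'`) to the pivot `p x` of the surrounding cell (for
the key `K`). -/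
def IsLink {V : Type u} (G : SimpleGraph V) (K K' : V → ℕ) (p : V → V) (u x : V) : Prop :=
  K u = K x ∧ G.Adj (p x) u ∧ ∃ y, K' y = K' x ∧ G.Adj u y

/-- The cells of `K'` are the components of the graphs that are obtained from the cells of `K` by
separating the neighbours from the non-neighbours of the pivot. -/
structure IsRefinementStep {V : Type u} (G : SimpleGraph V) (K K' : V → ℕ) (p p' : V → V) :
    Prop where
  lt_of_lt : ∀ x y, K x < K y → K' x < K' y
  eq_of_adj : ∀ x y, G.Adj x y → K x = K y → (G.Adj (p x) x ↔ G.Adj (p y) y) → K' x = K' y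
  connected : ∀ x y, K' x = K' y → Relation.ReflTransGen
    (fun x y => G.Adj x y ∧ K x = K y ∧ (G.Adj (p x) x ↔ G.Adj (p y) y)) x y
  pivot_eq : ∀ x y, K' x = K' y → p' x = p' y
  pivot : ∀ x, IsLink G K K' p (p' x) x ∨ (∀ u, ¬ IsLink G K K' p u x) ∧ K' (p' x) = K' x

/-- A sequence of refinement steps that starts with a single cell. -/
structure IsRefinement {V : Type u} (G : SimpleGraph V) (K : ℕ → V → ℕ) (p : ℕ → V → V) :
    Prop where
  zero : ∀ x y, K 0 x = K 0 y
  pivot_zero : ∀ x y, p 0 x = p 0 y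
  step : ∀ i, IsRefinementStep G (K i) (K (i + 1)) (p i) (p (i + 1))

/-! ### Cells and pivots along a refinement sequence -/

theorem Relation.ReflTransGen.exists_crossing {α : Type u} {r : α → α → Prop} {x y : α}
    (h : Relation.ReflTransGen r x y) {P : α → Prop} (hx : P x) (hy : ¬ P y) :
    ∃ a b, Relation.ReflTransGen r x a ∧ r a b ∧ P a ∧ ¬ P b := by
  induction h with
  | refl => exact absurd hx hy
  | @tail b c hb hbc ih =>
    by_cases hPb : P b
    · exact ⟨b, c, hb, hbc, hPb, hy⟩
    · exact ih hPb

namespace IsRefinement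

variable {V : Type u} {G : SimpleGraph V} {K : ℕ → V → ℕ} {p : ℕ → V → V}

theorem lt_of_lt (h : IsRefinement G K p) {i j : ℕ} (hij : i ≤ j) {x y : V}
    (hxy : K i x < K i y) : K j x < K j y := by
  induction hij with
  | refl => exact hxy
  | step _ ih => exact (h.step _).lt_of_lt _ _ ih

/-- Strict inequalities between keys persist, so by trichotomy later cells lie inside earlier ones.
-/
theorem eq_of_eq (h : IsRefinement G K p) {i j : ℕ} (hij : i ≤ j) {x y : V}
    (hxy : K j x = K j y) : K i x = K i y := by
  rcases lt_trichotomy (K i x) (K i y) with hlt | heq | hgt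
  · exact absurd hxy (h.lt_of_lt hij hlt).ne
  · exact heq
  · exact absurd hxy (h.lt_of_lt hij hgt).ne'

theorem pivot_eq (h : IsRefinement G K p) : ∀ (i : ℕ) {x y : V}, K i x = K i y → p i x = p i y
  | 0, x, y, _ => h.pivot_zero x y
  | i + 1, x, y, hxy => (h.step i).pivot_eq x y hxy

/-- Homogeneity: a cell is a component of a graph whose edges preserve adjacency to the previous
pivot. -/
theorem adj_pivot_iff (h : IsRefinement G K p) {i : ℕ} {x y : V}
    (hxy : K (i + 1) x = K (i + 1) y) : G.Adj (p i x) x ↔ G.Adj (p i x) y := by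
  have hp : p i x = p i y := h.pivot_eq i (h.eq_of_eq i.le_succ hxy)
  have hr := (h.step i).connected x y hxy
  rw [show G.Adj (p i x) y ↔ G.Adj (p i y) y by rw [hp]]
  clear hp hxy
  induction hr with
  | refl => rfl
  | tail _ hbc ih => exact ih.trans hbc.2.2

theorem exists_crossing (h : IsRefinement G K p) {i : ℕ} {x y : V}
    (hxy : K (i + 1) x = K (i + 1) y) {P : V → Prop} (hx : P x) (hy : ¬ P y) :
    ∃ a b, K (i + 1) a = K (i + 1) x ∧ K (i + 1) b = K (i + 1) x ∧ G.Adj a b ∧ P a ∧ ¬ P b := by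
  obtain ⟨a, b, hr, hab, ha, hb⟩ := ((h.step i).connected x y hxy).exists_crossing hx hy
  have hxa : K (i + 1) a = K (i + 1) x := by
    clear hab ha
    induction hr with
    | refl => rfl
    | tail _ hbc ih => exact ((h.step i).eq_of_adj _ _ hbc.1 hbc.2.1 hbc.2.2).symm.trans ih
  exact ⟨a, b, hxa, ((h.step i).eq_of_adj _ _ hab.1 hab.2.1 hab.2.2).symm.trans hxa, hab.1, ha, hb⟩

theorem exists_adj (h : IsRefinement G K p) {i : ℕ} {x y : V}
    (hxy : K (i + 1) x = K (i + 1) y) (hne : x ≠ y) :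
    ∃ z, K (i + 1) z = K (i + 1) x ∧ G.Adj x z := by
  obtain ⟨a, b, -, hb, hab, rfl, -⟩ := h.exists_crossing hxy (P := fun z => z = x) rfl hne.symm
  exact ⟨b, hb, hab⟩

/-- The fallback choice of a pivot does not occur here. If `w` is adjacent to the old pivot, a
neighbour of `w` in its new cell is a link. Otherwise the new cell is not all of the connected old
cell, so an edge leaves it inside the old cell; the outer end of this edge sees the old pivot, as it
would otherwise belong to the same component. -/
theorem isLink_succ (h : IsRefinement G K p) {i : ℕ} {w w' : V} (hne : w ≠ w')
    (hw : K (i + 2) w = K (i + 2) w')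
    (hadj : ∃ y, K (i + 1) y = K (i + 1) w ∧ G.Adj (p (i + 1) w) y) :
    IsLink G (K (i + 1)) (K (i + 2)) (p (i + 1)) (p (i + 2) w) w := by
  refine ((h.step (i + 1)).pivot w).resolve_right fun hcon => ?_
  by_cases hbit : G.Adj (p (i + 1) w) w
  · obtain ⟨z, hz, hwz⟩ := h.exists_adj hw hne
    exact hcon.1 z ⟨h.eq_of_eq (i + 1).le_succ hz, (h.adj_pivot_iff hz.symm).1 hbit, w, rfl,
      hwz.symm⟩
  · obtain ⟨y, hy, hpy⟩ := hadj
    obtain ⟨a, b, ha, hb, hab, hPa, hPb⟩ := h.exists_crossing hy.symm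
      (P := fun z => K (i + 2) z = K (i + 2) w) rfl
      (fun hy' => hbit ((h.adj_pivot_iff hy'.symm).2 hpy))
    have hpb : p (i + 1) b = p (i + 1) w := h.pivot_eq _ hb
    have hpa : p (i + 1) a = p (i + 1) w := h.pivot_eq _ ha
    refine hcon.1 b ⟨hb, ?_, a, hPa, hab.symm⟩
    by_contra hbb
    refine hPb (((h.step (i + 1)).eq_of_adj a b hab (ha.trans hb.symm) ?_).symm.trans hPa)
    rw [hpa, hpb]
    exact iff_of_false (fun haa => hbit ((h.adj_pivot_iff hPa.symm).2 haa)) hbb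

/-- This supplies the hypothesis of `isLink_succ`, with which it alternates in the induction. The
initial cell may be disconnected, so the induction starts after one step: there the pivot is a link,
or it lies in a connected cell with a second vertex. -/
theorem exists_adj_pivot (h : IsRefinement G K p) {w w' : V} (hne : w ≠ w') : ∀ {i : ℕ},
    K (i + 1) w = K (i + 1) w' → ∃ y, K (i + 1) y = K (i + 1) w ∧ G.Adj (p (i + 1) w) y
  | 0, hw => by
    rcases (h.step 0).pivot w with hl | ⟨-, hl⟩
    · exact hl.2.2
    · have : ∃ z, K (0 + 1) (p (0 + 1) w) = K (0 + 1) z ∧ p (0 + 1) w ≠ z := by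
        by_cases hpw : p (0 + 1) w = w
        · exact ⟨w', hl.trans hw, by rwa [hpw]⟩
        · exact ⟨w, hl, hpw⟩
      obtain ⟨z, hz, hpz⟩ := this
      obtain ⟨y, hy, hpy⟩ := h.exists_adj hz hpz
      exact ⟨y, hy.trans hl, hpy⟩
  | i + 1, hw => (h.isLink_succ hne hw
      (h.exists_adj_pivot hne (h.eq_of_eq (i + 1).le_succ hw))).2.2

/-- If there are no large cliques and no long induced paths, then the cells become singletons
after a bounded number of steps. -/
theorem injective (h : IsRefinement G K p) {r t : ℕ}
    (hr : ¬ (⊤ : SimpleGraph (Fin r)).IsIndContained G)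
    (ht : ¬ (SimpleGraph.pathGraph t).IsIndContained G) :
    Function.Injective (K (r * t + 1)) := by
  intro w w' hw
  by_contra hne
  -- The pivots considered are `p 1 w, p 2 w, …`, those of the successive cells of `w`.
  have link : ∀ i, i + 2 ≤ r * t + 1 →
      IsLink G (K (i + 1)) (K (i + 2)) (p (i + 1)) (p (i + 2) w) w := fun i hi =>
    h.isLink_succ hne (h.eq_of_eq hi hw)
      (h.exists_adj_pivot hne (h.eq_of_eq ((Nat.le_succ _).trans hi) hw))
  have consec : ∀ i, i + 2 ≤ r * t + 1 → G.Adj (p (i + 1) w) (p (i + 2) w) := fun i hi =>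
    (link i hi).2.1
  have mem : ∀ i j, i + 3 ≤ j → j ≤ r * t + 1 → K (i + 2) (p j w) = K (i + 2) w := by
    intro i j hij hj
    obtain ⟨k, rfl⟩ : ∃ k, j = k + 2 := ⟨j - 2, by omega⟩
    exact h.eq_of_eq (by omega) (link k hj).1
  -- Later pivots cannot be told apart from `w` by `p (i + 1) w`: they share the cell of level `i +
  -- 2`.
  have far : ∀ i j, i + 3 ≤ j → j ≤ r * t + 1 →
      (G.Adj (p (i + 1) w) w ↔ G.Adj (p (i + 1) w) (p j w)) := fun i j hij hj =>
    h.adj_pivot_iff (mem i j hij hj).symm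
  have ones : ∀ i j, i + 2 ≤ j → j ≤ r * t + 1 → G.Adj (p (i + 1) w) w →
      G.Adj (p (i + 1) w) (p j w) := by
    intro i j hij hj hbit
    rcases hij.eq_or_lt with rfl | hlt
    · exact consec i hj
    · exact (far i j hlt hj).1 hbit
  -- A repeated pivot would inherit a neighbour in a small cell around `w`, and by homogeneity would
  -- be adjacent to `w`.
  have zeros : ∀ i j, i + 3 ≤ j → j ≤ r * t + 1 → ¬ G.Adj (p (i + 1) w) w →
      p (i + 1) w ≠ p j w := by
    intro i j hij hj hbit heq
    obtain ⟨k, rfl⟩ : ∃ k, j = k + 2 := ⟨j - 2, by omega⟩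
    obtain ⟨y, hy, hpy⟩ := (link k hj).2.2
    rw [← heq] at hpy
    exact hbit ((h.adj_pivot_iff (h.eq_of_eq (by omega) hy).symm).2 hpy)
  -- A block of `t` consecutive pivots, none adjacent to `w`, would be an induced path.
  have block : ∀ k : Fin r, ∃ i, i < t ∧ G.Adj (p (k * t + i + 1) w) w := by
    intro k
    by_contra! hcon
    have hk : (k : ℕ) * t + t ≤ r * t := by
      calc (k : ℕ) * t + t = (k + 1) * t := by ring
        _ ≤ r * t := Nat.mul_le_mul_right _ k.2
    have hlt : ∀ a b : Fin t, (a : ℕ) < b →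
        p (k * t + a + 1) w ≠ p (k * t + b + 1) w ∧
        (G.Adj (p (k * t + a + 1) w) (p (k * t + b + 1) w) ↔ (a : ℕ) + 1 = b) := by
      intro a b hab
      have ha := a.2
      have hb := b.2
      rcases (Nat.succ_le_of_lt hab).eq_or_lt with heq | hlt
      · have hadj := consec (k * t + a) (by omega)
        rw [show k * t + b + 1 = (k : ℕ) * t + a + 2 by omega]
        exact ⟨hadj.ne, iff_of_true hadj heq⟩
      · refine ⟨zeros _ _ (by omega) (by omega) (hcon a ha), iff_of_false ?_ (by omega)⟩
        rw [← far _ _ (by omega) (by omega)]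
        exact hcon a ha
    refine ht ⟨⟨⟨fun a => p (k * t + a + 1) w, fun a b hab => ?_⟩, fun {a b} => ?_⟩⟩
    · by_contra hab'
      rcases lt_or_gt_of_ne (fun hv => hab' (Fin.ext hv) : (a : ℕ) ≠ b) with hl | hl
      · exact (hlt a b hl).1 hab
      · exact (hlt b a hl).1 hab.symm
    · rw [SimpleGraph.pathGraph_adj]
      change G.Adj (p (k * t + a + 1) w) (p (k * t + b + 1) w) ↔ _
      rcases lt_trichotomy (a : ℕ) b with hl | hl | hl
      · rw [(hlt a b hl).2]
        omega
      · obtain rfl := Fin.ext hl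
        simp
      · rw [G.adj_comm, (hlt b a hl).2]
        omega
  choose f hft hf using block
  -- One pivot adjacent to `w` from each block: together they form a clique.
  have hadj : ∀ a b : Fin r, a < b →
      G.Adj (p (a * t + f a + 1) w) (p (b * t + f b + 1) w) := by
    intro a b hab
    have h1 : (a : ℕ) * t + t ≤ b * t := by
      calc (a : ℕ) * t + t = (a + 1) * t := by ring
        _ ≤ b * t := Nat.mul_le_mul_right _ hab
    have h2 : (b : ℕ) * t + t ≤ r * t := by
      calc (b : ℕ) * t + t = (b + 1) * t := by ring
        _ ≤ r * t := Nat.mul_le_mul_right _ b.2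
    have ha := hft a
    have hb := hft b
    exact ones _ _ (by omega) (by omega) (hf a)
  have hadj' : ∀ a b : Fin r, a ≠ b →
      G.Adj (p (a * t + f a + 1) w) (p (b * t + f b + 1) w) := by
    intro a b hab
    rcases lt_or_gt_of_ne hab with hl | hl
    · exact hadj a b hl
    · exact (hadj b a hl).symm
  refine hr ⟨⟨⟨fun a => p (a * t + f a + 1) w, fun a b hab => ?_⟩, fun {a b} => ?_⟩⟩
  · by_contra hab'
    exact (hadj' a b hab').ne hab
  · rw [SimpleGraph.top_adj]
    exact ⟨fun hab heq => hab.ne (by rw [heq]), hadj' a b⟩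

end IsRefinement

universe v

/-! ### Induced matchings across a cut -/

/-- Ramsey's theorem for graphs. -/
theorem SimpleGraph.exists_clique_or_indep (r s : ℕ) : ∃ N : ℕ, ∀ (V : Type u) (G : SimpleGraph V)
    (S : Finset V), N ≤ S.card →
      (∃ T ⊆ S, T.card = r ∧ ∀ x ∈ T, ∀ y ∈ T, x ≠ y → G.Adj x y) ∨
      (∃ T ⊆ S, T.card = s ∧ ∀ x ∈ T, ∀ y ∈ T, ¬ G.Adj x y) := by
  classical
  induction hm : r + s generalizing r s with
  | zero => exact ⟨0, fun V G S _ => .inl ⟨∅, by simp, by simp; omega, by simp⟩⟩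
  | succ m ih =>
    rcases r with - | r
    · exact ⟨0, fun V G S _ => .inl ⟨∅, by simp, by simp, by simp⟩⟩
    rcases s with - | s
    · exact ⟨0, fun V G S _ => .inr ⟨∅, by simp, by simp, by simp⟩⟩
    obtain ⟨N₁, h₁⟩ := ih r (s + 1) (by omega)
    obtain ⟨N₂, h₂⟩ := ih (r + 1) s (by omega)
    refine ⟨N₁ + N₂ + 1, fun V G S hS => ?_⟩
    obtain ⟨x, hx⟩ : S.Nonempty := Finset.card_pos.1 (by omega)
    have hcard := Finset.card_filter_add_card_filter_not (s := S.erase x) (fun y => G.Adj x y)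
    rw [Finset.card_erase_of_mem hx] at hcard
    have hsub : ∀ {P : V → Prop} [DecidablePred P] {T : Finset V}, T ⊆ (S.erase x).filter P →
        T ⊆ S ∧ x ∉ T ∧ ∀ y ∈ T, P y := by
      intro P _ T hT
      refine ⟨fun y hy => Finset.mem_of_mem_erase (Finset.mem_filter.1 (hT hy)).1, fun hxT => ?_,
        fun y hy => (Finset.mem_filter.1 (hT hy)).2⟩
      exact Finset.notMem_erase x S (Finset.mem_filter.1 (hT hxT)).1
    by_cases hN : N₁ ≤ ((S.erase x).filter (fun y => G.Adj x y)).card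
    · rcases h₁ V G _ hN with ⟨T, hT, hc, hcl⟩ | ⟨T, hT, hc, hin⟩
      · obtain ⟨hTS, hxT, hadj⟩ := hsub hT
        refine .inl ⟨insert x T, Finset.insert_subset hx hTS, by
          rw [Finset.card_insert_of_notMem hxT, hc], ?_⟩
        simp only [Finset.mem_insert]
        rintro y (rfl | hy) z (rfl | hz) hne
        · exact absurd rfl hne
        · exact hadj z hz
        · exact (hadj y hy).symm
        · exact hcl y hy z hz hne
      · exact .inr ⟨T, (hsub hT).1, hc, hin⟩
    · rcases h₂ V G ((S.erase x).filter (fun y => ¬ G.Adj x y)) (by omega) with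
        ⟨T, hT, hc, hcl⟩ | ⟨T, hT, hc, hin⟩
      · exact .inl ⟨T, (hsub hT).1, hc, hcl⟩
      · obtain ⟨hTS, hxT, hadj⟩ := hsub hT
        refine .inr ⟨insert x T, Finset.insert_subset hx hTS, by
          rw [Finset.card_insert_of_notMem hxT, hc], ?_⟩
        simp only [Finset.mem_insert]
        rintro y (rfl | hy) z (rfl | hz)
        · exact G.irrefl
        · exact hadj z hz
        · exact fun h => hadj y hy h.symm
        · exact hin y hy z hz

/-- Ramsey's theorem for the graph pulled back along `a` to the indices. Injectivity of `a` is not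
needed, as adjacent indices have distinct images. -/
theorem exists_indep_of_not_isIndContained (r s : ℕ) : ∃ N : ℕ, ∀ (ι : Type v) (V : Type u)
    (G : SimpleGraph V) (a : ι → V) (S : Finset ι),
    ¬ (⊤ : SimpleGraph (Fin r)).IsIndContained G → N ≤ S.card →
      ∃ T ⊆ S, T.card = s ∧ ∀ i ∈ T, ∀ j ∈ T, ¬ G.Adj (a i) (a j) := by
  obtain ⟨N, h⟩ := SimpleGraph.exists_clique_or_indep.{v} r s
  refine ⟨N, fun ι V G a S hG hS => (h ι (G.comap a) S hS).resolve_left ?_⟩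
  rintro ⟨T, -, hc, hcl⟩
  let e := T.equivFinOfCardEq hc
  have hadj : ∀ i j : Fin r, i ≠ j → G.Adj (a (e.symm i)) (a (e.symm j)) := fun i j hij =>
    hcl _ (e.symm i).2 _ (e.symm j).2 fun h => hij (e.symm.injective (Subtype.ext h))
  refine hG ⟨⟨⟨fun i => a (e.symm i), fun i j hij => ?_⟩, fun {i j} => ?_⟩⟩
  · by_contra hne
    exact (hadj i j hne).ne hij
  · rw [SimpleGraph.top_adj]
    exact ⟨fun h heq => h.ne (by rw [heq]), hadj i j⟩

/-- A vertex `v` that is adjacent to one end of each edge of an induced matching gives rise to an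
induced `1`-subdivided star. -/
theorem subdividedStar_isIndContained {V : Type u} {G : SimpleGraph V} {s : ℕ} {v : V}
    {a b : Fin s → V} (hva : ∀ i, G.Adj v (a i)) (hvb : ∀ i, ¬ G.Adj v (b i))
    (hne : ∀ i, b i ≠ v) (hab : ∀ i j, G.Adj (a i) (b j) ↔ i = j)
    (haa : ∀ i j, ¬ G.Adj (a i) (a j)) (hbb : ∀ i j, ¬ G.Adj (b i) (b j)) :
    (subdividedStar s).IsIndContained G := by
  have hex : ∀ e : (completeBipartiteGraph (Fin 1) (Fin s)).edgeSet,
      ∃ i, (e : Sym2 (Fin 1 ⊕ Fin s)) = s(Sum.inl 0, Sum.inr i) := by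
    rintro ⟨e, he⟩
    induction e with
    | h x y =>
      rw [SimpleGraph.mem_edgeSet] at he
      rcases x with x | x <;> rcases y with y | y <;> simp at he
      · obtain rfl := Subsingleton.elim x 0
        exact ⟨y, rfl⟩
      · obtain rfl := Subsingleton.elim y 0
        exact ⟨x, Sym2.eq_swap⟩
  choose ix hix using hex
  have hainj : ∀ i j, a i = a j → i = j := fun i j h => (hab i j).1 (by
    rw [h]; exact (hab j j).2 rfl)
  have hbinj : ∀ i j, b i = b j → i = j := fun i j h => (hab i j).1 (by
    rw [← h]; exact (hab i i).2 rfl)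
  have hanb : ∀ i j, a i ≠ b j := fun i j h => hvb j (h ▸ hva i)
  have hixinj : ∀ e f, ix e = ix f → e = f := fun e f h => Subtype.ext (by rw [hix, hix, h])
  -- The centre goes to `v`, the leaves to the `b i`, and the subdivision vertices to the `a i`.
  let φ : (Fin 1 ⊕ Fin s) ⊕ (completeBipartiteGraph (Fin 1) (Fin s)).edgeSet → V :=
    Sum.elim (Sum.elim (fun _ => v) b) (fun e => a (ix e))
  refine ⟨⟨⟨φ, ?_⟩, ?_⟩⟩
  · rintro ((x | i) | e) ((y | j) | f) h
    · rw [Subsingleton.elim x y]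
    · exact absurd h.symm (hne j)
    · exact absurd h (hva _).ne
    · exact absurd h (hne i)
    · rw [hbinj i j h]
    · exact absurd h.symm (hanb _ _)
    · exact absurd h.symm (hva _).ne
    · exact absurd h (hanb _ _)
    · rw [hixinj e f (hainj _ _ h)]
  · have key : ∀ x e, (oneSubdivision (completeBipartiteGraph (Fin 1) (Fin s))).Adj
        (Sum.inl x) (Sum.inr e) ↔ x ∈ (e : Sym2 (Fin 1 ⊕ Fin s)) := by
      intro x e
      rw [oneSubdivision, SimpleGraph.fromRel_adj]
      constructor
      · rintro ⟨-, ⟨v, f, hv, hf, hvf⟩ | ⟨v, f, hv, -⟩⟩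
        · rwa [Sum.inl.inj hv, Sum.inr.inj hf]
        · exact absurd hv Sum.inr_ne_inl
      · exact fun h => ⟨Sum.inl_ne_inr, .inl ⟨x, e, rfl, rfl, h⟩⟩
    have key' : ∀ x e, G.Adj (φ (Sum.inl x)) (φ (Sum.inr e)) ↔
        x ∈ (e : Sym2 (Fin 1 ⊕ Fin s)) := by
      rintro (x | i) e
      · obtain rfl := Subsingleton.elim x 0
        exact iff_of_true (hva _) (by rw [hix]; simp)
      · rw [hix]
        change G.Adj (b i) (a (ix e)) ↔ _
        rw [G.adj_comm, hab]
        simp [eq_comm]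
    rintro (x | e) (y | f)
    · refine iff_of_false ?_ (by simp [oneSubdivision])
      rcases x with x | i <;> rcases y with y | j
      · exact G.irrefl
      · exact hvb j
      · exact fun h => hvb i h.symm
      · exact hbb i j
    · exact (key' x f).trans (key x f).symm
    · rw [SimpleGraph.adj_comm, SimpleGraph.adj_comm (oneSubdivision _)]
      exact (key' y e).trans (key y e).symm
    · exact iff_of_false (haa _ _) (by simp [oneSubdivision])

/-- Thinning out by Ramsey's theorem, for the `a`-ends and then for the `b`-ends, leaves an induced
subdivided star centred at `x`. -/
theorem exists_card_bound_of_pivot (r s : ℕ) : ∃ N : ℕ, ∀ (ι : Type v) (V : Type u)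
    (G : SimpleGraph V) (a b : ι → V) (x : V) (S : Finset ι),
    ¬ (⊤ : SimpleGraph (Fin r)).IsIndContained G → ¬ (subdividedStar s).IsIndContained G →
    (∀ i ∈ S, G.Adj x (a i)) → (∀ i ∈ S, ¬ G.Adj x (b i)) →
    (∀ i ∈ S, ∀ j ∈ S, G.Adj (a i) (b j) ↔ i = j) → S.card ≤ N := by
  obtain ⟨N₁, h₁⟩ := exists_indep_of_not_isIndContained.{u, v} r (s + 2)
  obtain ⟨N₂, h₂⟩ := exists_indep_of_not_isIndContained.{u, v} r N₁
  refine ⟨N₂, fun ι V G a b x S hr hs hxa hxb hab => ?_⟩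
  by_contra! hS
  obtain ⟨T₂, hT₂, hc₂, ha⟩ := h₂ ι V G a S hr hS.le
  obtain ⟨T, hT, hc, hb⟩ := h₁ ι V G b T₂ hr hc₂.ge
  have hTS : ∀ {i}, i ∈ T → i ∈ S := fun hi => hT₂ (hT hi)
  let e := T.equivFinOfCardEq hc
  let f : Fin s → ι := fun i => e.symm (i.castAdd 2)
  have hf : ∀ i, f i ∈ T := fun i => (e.symm _).2
  have hfinj : ∀ i j, f i = f j ↔ i = j := by
    intro i j
    simp [f, Subtype.ext_iff.symm]
  refine hs (subdividedStar_isIndContained (v := x) (a := a ∘ f) (b := b ∘ f)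
    (fun i => hxa _ (hTS (hf i))) (fun i => hxb _ (hTS (hf i))) (fun i hi => ?_)
    (fun i j => (hab _ (hTS (hf i)) _ (hTS (hf j))).trans (hfinj i j))
    (fun i j => ha _ (hT (hf i)) _ (hT (hf j))) (fun i j => hb _ (hf i) _ (hf j)))
  -- The centre is not one of the `b`-ends: it sees `a k` for a second index `k`, whereas `b (f i)`
  -- does not. Asking Ramsey's theorem for `s + 2` indices guarantees such a `k`.
  obtain ⟨k, hk, hki⟩ := Finset.exists_mem_ne (by omega : 1 < T.card) (f i)
  have hadj := hxa k (hTS hk)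
  rw [← hi, G.adj_comm] at hadj
  exact hki ((hab k (hTS hk) _ (hTS (hf i))).1 hadj)

/-- A bound for the sizes of the induced matchings in the bipartite graph between `A` and its
complement. -/
theorem cutmim_le {V : Type u} {G : SimpleGraph V} {A : Set V} {c : ℕ}
    (h : ∀ (m : ℕ) (a b : Fin m → V), (∀ i, a i ∈ A) → (∀ i, b i ∉ A) →
      (∀ i j, G.Adj (a i) (b j) ↔ i = j) → m ≤ c) :
    cutmim G A Aᶜ ≤ c := by
  refine iSup₂_le fun M hM => ?_
  by_contra! hlt
  -- The matching may be infinite, so `c + 1` of its edges are selected.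
  obtain ⟨S, hS, hcard⟩ := Set.exists_subset_encard_eq (k := (c + 1 : ℕ))
    (by rw [Nat.cast_add, Nat.cast_one]; exact Order.add_one_le_of_lt hlt)
  have hfin : S.Finite := Set.finite_of_encard_eq_coe hcard
  have hncard : S.ncard = c + 1 := by rw [Set.ncard, hcard]; rfl
  have : Finite S := hfin
  let e : Fin (c + 1) ≃ S := (Finite.equivFinOfCardEq hncard).symm
  have hex : ∀ i, ∃ a b, a ∈ A ∧ b ∉ A ∧ M.Adj a b ∧ ((e i : S) : Sym2 V) = s(a, b) := by
    intro i
    have hq' := hS (e i).2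
    generalize ((e i : S) : Sym2 V) = q at hq'
    induction q with
    | h x y =>
      rw [SimpleGraph.Subgraph.mem_edgeSet] at hq'
      rcases (M.adj_sub hq').2 with ⟨hx, hy⟩ | ⟨hx, hy⟩
      · exact ⟨x, y, hx, hy, hq', rfl⟩
      · exact ⟨y, x, hy, hx, hq'.symm, Sym2.eq_swap⟩
  choose a b ha hb hab he using hex
  have := h (c + 1) a b ha hb fun i j => ⟨fun hadj => ?_, ?_⟩
  · omega
  · have hM' : M.Adj (a i) (b j) := hM.2 (M.edge_vert (hab i)) (M.edge_vert (hab j).symm)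
      ⟨hadj, .inl ⟨ha i, hb j⟩⟩
    have h1 : b j = b i := (hM.1 (M.edge_vert (hab i))).unique hM' (hab i)
    have h2 : a i = a j := (hM.1 (M.edge_vert (hab j).symm)).unique hM'.symm (hab j).symm
    exact e.injective (Subtype.ext (by rw [he, he, h1, h2]))
  · rintro rfl
    exact (M.adj_sub (hab i)).1

/-- In the order given by a refinement sequence whose last key is injective, all cuts have bounded
induced matchings. -/
theorem IsRefinement.exists_cut_bound (r s D : ℕ) : ∃ c : ℕ, ∀ (V : Type u) (G : SimpleGraph V)
    (K : ℕ → V → ℕ) (p : ℕ → V → V), IsRefinement G K p →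
    ¬ (⊤ : SimpleGraph (Fin r)).IsIndContained G → ¬ (subdividedStar s).IsIndContained G →
    ∀ (m : ℕ) (a b : Fin m → V),
      (∀ i j, K D (a i) < K D (b j)) → (∀ i j, G.Adj (a i) (b j) ↔ i = j) → m ≤ c := by
  classical
  obtain ⟨N, hN⟩ := exists_card_bound_of_pivot.{u, 0} r s
  refine ⟨(D + 1) * 2 * N, fun V G K p h hr hs m a b hcut hab => ?_⟩
  -- The last level at which the ends of edge `i` share a cell; they do at level `0` and do not at
  -- level `D`.
  have hlevel : ∀ i, ∃ l ≤ D, K l (a i) = K l (b i) ∧ K (l + 1) (a i) ≠ K (l + 1) (b i) := by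
    intro i
    have hne : K D (a i) ≠ K D (b i) := (hcut i i).ne
    by_contra! hcon
    have : ∀ l ≤ D + 1, K l (a i) = K l (b i) := by
      intro l
      induction l with
      | zero => exact fun _ => h.zero _ _
      | succ l ih => exact fun hl => hcon l (by omega) (ih (by omega))
    exact hne (this D (by omega))
  choose l hlD hl hl' using hlevel
  -- If the two cells were different, one whole edge would precede the other in the final order,
  -- which puts a `b`-end before an `a`-end.
  have hcell : ∀ i j, l i = l j → K (l i) (a i) = K (l i) (a j) := by
    intro i j hij
    rcases lt_trichotomy (K (l i) (a i)) (K (l i) (a j)) with hlt | heq | hgt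
    · rw [hl i] at hlt
      exact absurd (h.lt_of_lt (hlD i) hlt) (hcut j i).not_gt
    · exact heq
    · rw [hij, hl j] at hgt
      exact absurd (h.lt_of_lt (hlD j) hgt) (hcut i j).not_gt
  -- Adjacent vertices cannot be separated by taking components, so the pivot sees exactly one end.
  have hbit : ∀ i, ¬ (G.Adj (p (l i) (a i)) (a i) ↔ G.Adj (p (l i) (a i)) (b i)) := by
    intro i hiff
    refine hl' i ((h.step (l i)).eq_of_adj _ _ ((hab i i).2 rfl) (hl i) ?_)
    rwa [← h.pivot_eq (l i) (hl i)]
  let color : Fin m → Fin (D + 1) × Bool := fun i =>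
    (⟨l i, Nat.lt_succ_of_le (hlD i)⟩, decide (G.Adj (p (l i) (a i)) (a i)))
  have hclass : ∀ q, (Finset.univ.filter fun i => color i = q).card ≤ N := by
    intro q
    rcases (Finset.univ.filter fun i => color i = q).eq_empty_or_nonempty with h0 | ⟨k, hk⟩
    · simp [h0]
    have hkq : color k = q := (Finset.mem_filter.1 hk).2
    have hmem : ∀ i ∈ Finset.univ.filter fun i => color i = q,
        p (l i) (a i) = p (l k) (a k) ∧
        (G.Adj (p (l i) (a i)) (a i) ↔ G.Adj (p (l k) (a k)) (a k)) := by
      intro i hi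
      have hik : color i = color k := (Finset.mem_filter.1 hi).2.trans hkq.symm
      have h1 : l i = l k := congrArg (fun z => (z.1 : ℕ)) hik
      have h2 : decide (G.Adj (p (l i) (a i)) (a i)) = decide (G.Adj (p (l k) (a k)) (a k)) :=
        congrArg Prod.snd hik
      refine ⟨?_, decide_eq_decide.1 h2⟩
      rw [← h1]
      exact h.pivot_eq _ (hcell i k h1)
    by_cases hk' : G.Adj (p (l k) (a k)) (a k)
    · refine hN _ V G a b (p (l k) (a k)) _ hr hs (fun i hi => ?_) (fun i hi hi' => ?_)
        fun i _ j _ => hab i j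
      · rw [← (hmem i hi).1]
        exact (hmem i hi).2.2 hk'
      · rw [← (hmem i hi).1] at hi'
        exact hbit i (iff_of_true ((hmem i hi).2.2 hk') hi')
    -- The pivot sees the `b`-ends, so the two sides exchange roles.
    · refine hN _ V G b a (p (l k) (a k)) _ hr hs (fun i hi => ?_) (fun i hi hi' => ?_)
        fun i _ j _ => (G.adj_comm _ _).trans ((hab j i).trans eq_comm)
      · rw [← (hmem i hi).1]
        by_contra hi'
        exact hbit i (iff_of_false (fun hc => hk' ((hmem i hi).2.1 hc)) hi')
      · rw [← (hmem i hi).1] at hi'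
        exact hk' ((hmem i hi).2.1 hi')
  calc m = (Finset.univ : Finset (Fin m)).card := by simp
    _ = ∑ q, (Finset.univ.filter fun i => color i = q).card :=
        Finset.card_eq_sum_card_fiberwise fun i _ => Finset.mem_univ (color i)
    _ ≤ ∑ _q : Fin (D + 1) × Bool, N := Finset.sum_le_sum fun q _ => hclass q
    _ = (D + 1) * 2 * N := by simp

/-! ### Caterpillars -/

/-- The caterpillar on `m` vertices: every even number `i` is joined to `i + 1` and `i + 2`. -/
def caterpillar (m : ℕ) : SimpleGraph (Fin m) where
  Adj x y := ((x : ℕ) % 2 = 0 ∧ ((y : ℕ) = x + 1 ∨ (y : ℕ) = x + 2)) ∨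
    ((y : ℕ) % 2 = 0 ∧ ((x : ℕ) = y + 1 ∨ (x : ℕ) = y + 2))
  symm := ⟨fun _ _ h => h.symm⟩
  loopless := ⟨fun x h => by omega⟩

namespace caterpillar

theorem adj_iff {m : ℕ} {x y : Fin m} : (caterpillar m).Adj x y ↔
    ((x : ℕ) % 2 = 0 ∧ ((y : ℕ) = x + 1 ∨ (y : ℕ) = x + 2)) ∨
    ((y : ℕ) % 2 = 0 ∧ ((x : ℕ) = y + 1 ∨ (x : ℕ) = y + 2)) := Iff.rfl

/-- `z` is separated from the vertex `0` by the edge between `y` and its predecessor. -/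
def Below (y z : ℕ) : Prop := (y % 2 = 1 ∧ z = y) ∨ (y % 2 = 0 ∧ y ≤ z)

theorem reachable_zero {m : ℕ} (hm : 0 < m) (x : Fin m) :
    (caterpillar m).Reachable ⟨0, hm⟩ x := by
  obtain ⟨x, hx⟩ := x
  induction x using Nat.strong_induction_on with
  | _ x ih =>
    rcases Nat.eq_zero_or_pos x with rfl | hpos
    · exact .refl _
    · refine (ih (2 * ((x - 1) / 2)) (by omega) (by omega)).trans (SimpleGraph.Adj.reachable ?_)
      rw [adj_iff]
      dsimp only
      omega

end caterpillar

theorem SimpleGraph.Reachable.of_closed {V : Type u} {H : SimpleGraph V} {x y : V}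
    (h : H.Reachable x y) {P : V → Prop} (hP : ∀ a b, H.Adj a b → P a → P b) (hx : P x) : P y := by
  obtain ⟨w⟩ := h
  induction w with
  | nil => exact hx
  | cons hadj _ ih => exact ih (hP _ _ hadj hx)

theorem SimpleGraph.Reachable.deleteEdges_or {V : Type u} {H : SimpleGraph V} {x y z : V}
    (h : H.Reachable x z) : (H.deleteEdges {s(x, y)}).Reachable x z ∨
      (H.deleteEdges {s(x, y)}).Reachable y z := by
  refine h.of_closed (P := fun z => (H.deleteEdges {s(x, y)}).Reachable x z ∨
      (H.deleteEdges {s(x, y)}).Reachable y z) (fun a b hab hP => ?_) (.inl (.refl _))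
  by_cases he : s(a, b) = s(x, y)
  · rw [Sym2.eq_iff] at he
    rcases he with ⟨-, rfl⟩ | ⟨-, rfl⟩
    · exact .inr (.refl _)
    · exact .inl (.refl _)
  · have hadj : (H.deleteEdges {s(x, y)}).Adj a b := by
      rw [SimpleGraph.deleteEdges_adj]
      exact ⟨hab, he⟩
    exact hP.imp (fun h => h.trans hadj.reachable) (fun h => h.trans hadj.reachable)

namespace caterpillar

/-- `Below y` changes only across the edge between `x` and `y`; so it is constant on the components
left by its deletion. -/
theorem below_iff {m : ℕ} {x y a b : Fin m} (hx : (x : ℕ) % 2 = 0)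
    (hy : (y : ℕ) = x + 1 ∨ (y : ℕ) = x + 2)
    (hab : ((caterpillar m).deleteEdges {s(x, y)}).Adj a b) : Below y a ↔ Below y b := by
  rw [SimpleGraph.deleteEdges_adj, adj_iff, Set.mem_singleton_iff, Sym2.eq_iff] at hab
  simp only [Fin.ext_iff] at hab
  unfold Below
  omega

theorem reachable_iff {m : ℕ} {x y : Fin m} (hx : (x : ℕ) % 2 = 0)
    (hy : (y : ℕ) = x + 1 ∨ (y : ℕ) = x + 2) (z : Fin m) :
    (((caterpillar m).deleteEdges {s(x, y)}).Reachable x z ↔ ¬ Below y z) ∧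
    (((caterpillar m).deleteEdges {s(x, y)}).Reachable y z ↔ Below y z) := by
  have h1 : ((caterpillar m).deleteEdges {s(x, y)}).Reachable x z → ¬ Below y z := fun h =>
    h.of_closed (P := fun z => ¬ Below y z) (fun a b hab => mt (below_iff hx hy hab).2)
      (by unfold Below; omega)
  have h2 : ((caterpillar m).deleteEdges {s(x, y)}).Reachable y z → Below y z := fun h =>
    h.of_closed (P := fun z => Below y z) (fun a b hab => (below_iff hx hy hab).1)
      (by unfold Below; omega)
  have h3 : (caterpillar m).Reachable x z :=
    (reachable_zero x.pos x).symm.trans (reachable_zero x.pos z)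
  exact ⟨⟨h1, fun h => h3.deleteEdges_or.resolve_right (mt h2 h)⟩,
    ⟨h2, fun h => h3.deleteEdges_or.resolve_left fun h' => h1 h' h⟩⟩

theorem isTree {m : ℕ} (hm : 0 < m) : (caterpillar m).IsTree where
  connected := by
    have : Nonempty (Fin m) := ⟨⟨0, hm⟩⟩
    exact ⟨fun x y => (reachable_zero hm x).symm.trans (reachable_zero hm y)⟩
  isAcyclic := by
    rw [SimpleGraph.isAcyclic_iff_forall_adj_isBridge]
    intro x y hxy
    rw [SimpleGraph.isBridge_iff]
    rcases adj_iff.1 hxy with ⟨hx, hy⟩ | ⟨hy, hx⟩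
    · intro h
      exact (reachable_iff hx hy y).1.1 h (by unfold Below; omega)
    · intro h
      rw [Sym2.eq_swap] at h
      exact (reachable_iff hy hx x).1.1 h.symm (by unfold Below; omega)

theorem ncard_neighborSet_le {m : ℕ} (x : Fin m) (s : Finset ℕ)
    (h : ∀ y, (caterpillar m).Adj x y → (y : ℕ) ∈ s) :
    ((caterpillar m).neighborSet x).ncard ≤ s.card := by
  rw [← Set.ncard_image_of_injective _ Fin.val_injective, ← Set.ncard_coe_finset]
  refine Set.ncard_le_ncard ?_ s.finite_toSet
  rintro _ ⟨y, hy, rfl⟩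
  exact h y hy

theorem ncard_neighborSet_le_three {m : ℕ} (x : Fin m) :
    ((caterpillar m).neighborSet x).ncard ≤ 3 := by
  rcases Nat.mod_two_eq_zero_or_one x with hx | hx
  · refine (ncard_neighborSet_le x {(x : ℕ) + 1, (x : ℕ) + 2, (x : ℕ) - 2} fun y hy => ?_).trans
      Finset.card_le_three
    rw [adj_iff] at hy
    simp only [Finset.mem_insert, Finset.mem_singleton]
    omega
  · refine (ncard_neighborSet_le x {(x : ℕ) - 1} fun y hy => ?_).trans (by simp)
    rw [adj_iff] at hy
    simp only [Finset.mem_singleton]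
    omega

/-- With `m` odd, the spine of even vertices ends at `m - 1`, which has no pendant neighbour and is
therefore a leaf too. -/
theorem ncard_neighborSet_le_one_iff {m : ℕ} (hm : m % 2 = 1) (x : Fin m) :
    ((caterpillar m).neighborSet x).ncard ≤ 1 ↔ (x : ℕ) % 2 = 1 ∨ (x : ℕ) + 1 = m := by
  have hxm := x.2
  constructor
  · intro h
    by_contra! hcon
    have h1 : (⟨x + 1, by omega⟩ : Fin m) ∈ (caterpillar m).neighborSet x := by
      rw [SimpleGraph.mem_neighborSet, adj_iff]
      dsimp only
      omega
    have h2 : (⟨x + 2, by omega⟩ : Fin m) ∈ (caterpillar m).neighborSet x := by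
      rw [SimpleGraph.mem_neighborSet, adj_iff]
      dsimp only
      omega
    have := (Set.ncard_le_one (Set.toFinite _)).1 h _ h1 _ h2
    simp at this
  · rintro (h | h)
    · refine (ncard_neighborSet_le x {(x : ℕ) - 1} fun y hy => ?_).trans (by simp)
      rw [adj_iff] at hy
      simp only [Finset.mem_singleton]
      omega
    · refine (ncard_neighborSet_le x {(x : ℕ) - 2} fun y hy => ?_).trans (by simp)
      have := y.2
      rw [adj_iff] at hy
      simp only [Finset.mem_singleton]
      omega

end caterpillar

/-! ### Branch decompositions from linear orders -/

/-- The branch decomposition of a nonempty set along a linear order, with a caterpillar as its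
tree. -/
noncomputable def linearDecomposition {V : Type u} {n : ℕ} (hn : 0 < n) (e : V ≃ Fin n) :
    BranchDecomposition V where
  size := 2 * n - 1
  tree := caterpillar (2 * n - 1)
  isTree := caterpillar.isTree (by omega)
  subcubic := caterpillar.ncard_neighborSet_le_three
  leaf := Equiv.ofBijective
    -- The vertex of rank `i` sits at the pendant leaf `2 * i + 1`; the minimum moves the last one
    -- to the end `2 * n - 2` of the spine.
    (fun v => ⟨⟨min (2 * (e v : ℕ) + 1) (2 * n - 2), by omega⟩, by
      rw [caterpillar.ncard_neighborSet_le_one_iff (by omega)]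
      dsimp only
      omega⟩) (by
      constructor
      · intro v w hvw
        rw [Subtype.mk.injEq, Fin.mk.injEq] at hvw
        have hv := (e v).2
        have hw := (e w).2
        exact e.injective (Fin.ext (by omega))
      · rintro ⟨x, hx⟩
        rw [caterpillar.ncard_neighborSet_le_one_iff (by omega)] at hx
        have hx' := x.2
        refine ⟨e.symm ⟨(x : ℕ) / 2, by omega⟩, ?_⟩
        rw [Subtype.mk.injEq, Fin.ext_iff]
        simp only [Equiv.apply_symm_apply]
        omega)

theorem linearDecomposition_leaf {V : Type u} {n : ℕ} (hn : 0 < n) (e : V ≃ Fin n) (v : V) :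
    (((linearDecomposition hn e).leaf v : Fin (linearDecomposition hn e).size) : ℕ) =
      min (2 * (e v : ℕ) + 1) (2 * n - 2) := rfl

theorem cutmim_comm {V : Type u} (G : SimpleGraph V) (A B : Set V) :
    cutmim G A B = cutmim G B A := by
  rw [cutmim, cutmim, SimpleGraph.between_comm]

/-- Spine edges cut off the prefixes of the order, which `h` controls. Pendant edges cut off a
single vertex, whence the requirement `1 ≤ c`. -/
theorem linearDecomposition_mimw_le {V : Type u} {G : SimpleGraph V} {n : ℕ} (hn : 0 < n)
    (e : V ≃ Fin n) {c : ℕ} (hc : 1 ≤ c)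
    (h : ∀ (θ m : ℕ) (a b : Fin m → V), (∀ i, (e (a i) : ℕ) ≤ θ) → (∀ i, θ < e (b i)) →
      (∀ i j, G.Adj (a i) (b j) ↔ i = j) → m ≤ c) :
    (linearDecomposition hn e).mimw G ≤ c := by
  have key : ∀ x y : Fin (2 * n - 1), (x : ℕ) % 2 = 0 → ((y : ℕ) = x + 1 ∨ (y : ℕ) = x + 2) →
      cutmim G {v | caterpillar.Below y (min (2 * (e v : ℕ) + 1) (2 * n - 2))}
        {v | caterpillar.Below y (min (2 * (e v : ℕ) + 1) (2 * n - 2))}ᶜ ≤ c := by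
    intro x y hx hy
    have hy2 := y.2
    rcases hy with hy | hy
    · refine cutmim_le fun m a b ha _ hab => ?_
      by_contra! hm
      have hval : ∀ i, (e (a i) : ℕ) = x / 2 := by
        intro i
        have := ha i
        simp only [caterpillar.Below, Set.mem_ofPred_eq] at this
        omega
      have hfin : (⟨0, by omega⟩ : Fin m) = ⟨1, by omega⟩ := by
        rw [← hab, e.injective (Fin.ext ((hval ⟨0, by omega⟩).trans (hval ⟨1, by omega⟩).symm)),
          hab]
      simp at hfin
    · rw [cutmim_comm]
      have hset : {v | caterpillar.Below y (min (2 * (e v : ℕ) + 1) (2 * n - 2))} =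
          {v | (e v : ℕ) ≤ x / 2}ᶜ := by
        ext v
        have := (e v).2
        simp only [caterpillar.Below, Set.mem_ofPred_eq, Set.mem_compl_iff]
        omega
      rw [hset, compl_compl]
      exact cutmim_le fun m a b ha hb hab => h _ m a b ha (fun i => not_le.1 (hb i)) hab
  refine iSup₂_le fun x y => iSup_le fun hxy => ?_
  rcases caterpillar.adj_iff.1 hxy with ⟨hx, hy⟩ | ⟨hy, hx⟩
  · have hside : (linearDecomposition hn e).side x y =
        {v | caterpillar.Below y (min (2 * (e v : ℕ) + 1) (2 * n - 2))}ᶜ := by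
      ext v
      exact (caterpillar.reachable_iff hx hy _).1
    rw [hside, compl_compl, cutmim_comm]
    exact key x y hx hy
  · have hside : (linearDecomposition hn e).side x y =
        {v | caterpillar.Below x (min (2 * (e v : ℕ) + 1) (2 * n - 2))} := by
      ext v
      have := (caterpillar.reachable_iff hy hx
        ((linearDecomposition hn e).leaf v : Fin (linearDecomposition hn e).size)).2
      rwa [(Sym2.eq_swap : (s(y, x) : Sym2 (Fin (2 * n - 1))) = s(x, y))] at this
    rw [hside]
    exact key y x hy hx

/-! ### The algorithm -/

namespace RAM

open Stmt

/-- The entry of the adjacency matrix (array `0`) in row `u` and column `w`. -/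
def adjEntry (u w : Expr) : Expr := .get 0 (.add (.mulSize u) w)

/-- This is positive if and only if `e` and `f` have the same value. -/
def eqTest (e f : Expr) : Expr := .sub (.lit 1) (.add (.sub e f) (.sub f e))

/-- Whether `x` is adjacent to its pivot (array `4`). -/
def pivotBit (x : Expr) : Expr := adjEntry (.get 4 x) x

/-- Replace the label (array `6`) of variable `3` by the label of variable `2`, everywhere. -/
def mergeLabels : Stmt :=
  .bind (.get 6 (.var 2)) <| .bind (.get 6 (.var 3)) <|
    .forAll (.ifPos (eqTest (.get 6 (.var 6)) (.var 5)) (.store 6 (.var 6) (.var 4)))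

/-- Label the components of the refined cells. -/
def labelComponents : Stmt :=
  .seq (.forAll (.store 6 (.var 2) (.var 2))) <|
    .forAll <| .forAll <| .ifPos (adjEntry (.var 2) (.var 3)) <|
      .ifPos (eqTest (.get 3 (.var 2)) (.get 3 (.var 3))) <|
      .ifPos (eqTest (pivotBit (.var 2)) (pivotBit (.var 3))) mergeLabels

/-- Find the new pivots (array `7`, indexed by labels). -/
def findPivots : Stmt :=
  .seq (.forAll (.store 7 (.get 6 (.var 2)) (.var 2))) <|
    .forAll <| .forAll <| .ifPos (adjEntry (.var 3) (.var 2)) <|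
      .ifPos (adjEntry (.get 4 (.var 2)) (.var 3)) <|
      .ifPos (eqTest (.get 3 (.var 3)) (.get 3 (.var 2))) <|
      .store 7 (.get 6 (.var 2)) (.var 3)

/-- Update the keys (array `3`) and the pivots (array `4`). -/
def updateKeys : Stmt :=
  .forAll <| .seq
    (.store 3 (.var 2) (.add (.mulSize (.get 3 (.var 2))) (.get 6 (.var 2))))
    (.store 4 (.var 2) (.get 7 (.get 6 (.var 2))))

/-- A refinement step. -/
def refineCells : Stmt := .seq labelComponents (.seq findPivots updateKeys)

/-! ### Correctness of one refinement step -/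

theorem eqTest_pos {ρ : ℕ → ℕ} {A : ℕ → ℕ → ℕ} {e f : Expr} :
    0 < (eqTest e f).eval ρ A ↔ e.eval ρ A = f.eval ρ A := by
  simp only [eqTest, Expr.eval]
  omega

/-- Array `0` holds the adjacency matrix of `G`. -/
def HoldsGraph {n : ℕ} (G : SimpleGraph (Fin n)) (A : ℕ → ℕ → ℕ) : Prop :=
  ∀ u w : Fin n, (0 < A 0 (u * n + w) ↔ G.Adj u w) ∧ A 0 (u * n + w) ≤ 1

theorem HoldsGraph.eq_iff {n : ℕ} {G : SimpleGraph (Fin n)} {A : ℕ → ℕ → ℕ}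
    (h : HoldsGraph G A) (u w u' w' : Fin n) :
    A 0 (u * n + w) = A 0 (u' * n + w') ↔ (G.Adj u w ↔ G.Adj u' w') := by
  have h1 := h u w
  have h2 := h u' w'
  rw [← h1.1, ← h2.1]
  omega

/-- The two labels are bound before the loop, which may overwrite the cells from which they were
read. -/
theorem mergeLabels_sem {n : ℕ} {ρ : ℕ → ℕ} {A : ℕ → ℕ → ℕ} (hn : ρ 0 = n) (z : ℕ) (hz : z < n) :
    mergeLabels.sem 4 ρ A 6 z = if A 6 z = A 6 (ρ 3) then A 6 (ρ 2) else A 6 z := by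
  subst hn
  rw [mergeLabels, Stmt.sem, Stmt.sem]
  have := sem_forAll (S := .ifPos (eqTest (.get 6 (.var 6)) (.var 5)) (.store 6 (.var 6) (.var 4)))
    (d := 6) (ρ := Function.update (Function.update ρ 4 (A 6 (ρ 2))) 5 (A 6 (ρ 3))) (A := A)
    (fun i B => ∀ z, B 6 z = if z < i ∧ A 6 z = A 6 (ρ 3) then A 6 (ρ 2) else A 6 z)
    (by simp) ?_
  · simpa [Expr.eval, hz, Function.update_apply] using this z
  · intro i B hi hB z
    simp only [Stmt.sem, eqTest_pos, Expr.eval, Function.update_apply]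
    simp
    by_cases h : B 6 i = A 6 (ρ 3)
    · rw [if_pos h]
      simp only [Function.update_apply, if_true]
      have hi' := hB i
      simp at hi'
      by_cases hzi : z = i
      · subst hzi
        simp [← hi', h]
      · have : z ≤ i ↔ z < i := by omega
        simp [hzi, hB z, this]
    · rw [if_neg h, hB z]
      have hi' := hB i
      simp at hi'
      by_cases hzi : z = i
      · subst hzi
        simp [← hi', h]
      · have : z ≤ i ↔ z < i := by omega
        simp [this]

theorem connected_of_merge {α : Type u} {r : α → α → Prop} (hr : ∀ x y, r x y → r y x)
    {L L' : α → ℕ} (h : ∀ x y, L x = L y → Relation.ReflTransGen r x y) {x y : α} (hxy : r x y)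
    (hL : ∀ z, L' z = if L z = L y then L x else L z) (z z' : α) (hz : L' z = L' z') :
    Relation.ReflTransGen r z z' := by
  rw [hL, hL] at hz
  split at hz <;> split at hz
  · rename_i h1 h2
    exact h _ _ (h1.trans h2.symm)
  · rename_i h1 h2
    exact ((h z y h1).tail (hr _ _ hxy)).trans (h _ _ hz)
  · rename_i h1 h2
    exact ((h z x hz).tail hxy).trans (h _ _ h2.symm)
  · exact h _ _ hz

/-- Adjacency in the same cell, with the same adjacency to the pivot. -/
def CellAdj {n : ℕ} (G : SimpleGraph (Fin n)) (K : Fin n → ℕ) (p : Fin n → Fin n) (x y : Fin n) :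
    Prop := G.Adj x y ∧ K x = K y ∧ (G.Adj (p x) x ↔ G.Adj (p y) y)

/-- Labels start distinct and are merged along edges only, so equal labels always mean connected
vertices. A merge never separates equal labels, so one pass over all pairs suffices. -/
theorem labelComponents_sem {n : ℕ} {G : SimpleGraph (Fin n)} {ρ : ℕ → ℕ} {A : ℕ → ℕ → ℕ}
    (hn : ρ 0 = n) (hA : HoldsGraph G A) {p : Fin n → Fin n} (hp : ∀ w : Fin n, A 4 w = p w) :
    (∀ x : Fin n, labelComponents.sem 2 ρ A 6 x < n) ∧
    (∀ x y : Fin n, labelComponents.sem 2 ρ A 6 x = labelComponents.sem 2 ρ A 6 y →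
      Relation.ReflTransGen (CellAdj G (fun w => A 3 w) p) x y) ∧
    ∀ x y : Fin n, CellAdj G (fun w => A 3 w) p x y →
      labelComponents.sem 2 ρ A 6 x = labelComponents.sem 2 ρ A 6 y := by
  subst hn
  set H := CellAdj G (fun w => A 3 w) p with hH
  let Good : (ℕ → ℕ → ℕ) → Prop := fun B => B 0 = A 0 ∧ B 3 = A 3 ∧ B 4 = A 4 ∧
    (∀ x : Fin (ρ 0), B 6 x < ρ 0) ∧
    ∀ x y : Fin (ρ 0), B 6 x = B 6 y → Relation.ReflTransGen H x y
  have hgood : Good ((Stmt.forAll (.store 6 (.var 2) (.var 2))).sem 2 ρ A) := by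
    have h6 := sem_forAll (S := .store 6 (.var 2) (.var 2)) (d := 2) (ρ := ρ) (A := A)
      (fun i B => ∀ x < i, B 6 x = x) (by simp) (by
        intro i B hi hB x hx
        simp only [Stmt.sem, Expr.eval, Function.update_self, Function.update_apply]
        split
        · omega
        · exact hB x (by omega))
    refine ⟨Keeps.sem_eq (by simp [Keeps]) _ _ _, Keeps.sem_eq (by simp [Keeps]) _ _ _,
      Keeps.sem_eq (by simp [Keeps]) _ _ _, fun x => ?_, fun x y hxy => ?_⟩
    · rw [h6 x x.2]
      exact x.2
    · rw [h6 x x.2, h6 y y.2] at hxy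
      rw [Fin.ext hxy]
  have hstep : ∀ (B : ℕ → ℕ → ℕ) (i j : ℕ) (hi : i < ρ 0) (hj : j < ρ 0), Good B → ∀ B',
      B' = Stmt.sem (.ifPos (adjEntry (.var 2) (.var 3)) <|
        .ifPos (eqTest (.get 3 (.var 2)) (.get 3 (.var 3))) <|
        .ifPos (eqTest (pivotBit (.var 2)) (pivotBit (.var 3))) mergeLabels) 4
        (Function.update (Function.update ρ 2 i) 3 j) B →
      Good B' ∧ (∀ x y, B 6 x = B 6 y → x < ρ 0 → y < ρ 0 → B' 6 x = B' 6 y) ∧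
      (H ⟨i, hi⟩ ⟨j, hj⟩ → B' 6 i = B' 6 j) := by
    intro B i j hi hj hB B' hB'
    obtain ⟨h0, h3, h4, hlt, hr⟩ := hB
    have hcond : B' = open Classical in if H ⟨i, hi⟩ ⟨j, hj⟩ then
        mergeLabels.sem 4 (Function.update (Function.update ρ 2 i) 3 j) B else B := by
      rw [hB']
      simp only [Stmt.sem, eqTest_pos, pivotBit, adjEntry, Expr.eval, Function.update_apply]
      simp only [Nat.reduceEqDiff, if_true, if_false, OfNat.zero_ne_ofNat, h0, h3, h4]
      have e1 := (hA ⟨i, hi⟩ ⟨j, hj⟩).1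
      have e2 := hA.eq_iff (p ⟨i, hi⟩) ⟨i, hi⟩ (p ⟨j, hj⟩) ⟨j, hj⟩
      rw [← hp, ← hp] at e2
      dsimp only at e1 e2
      rw [hH, CellAdj, ← e1, ← e2]
      split_ifs <;> first | rfl | tauto
    by_cases hij : H ⟨i, hi⟩ ⟨j, hj⟩
    · rw [if_pos hij] at hcond
      have hm : ∀ z < ρ 0, B' 6 z = if B 6 z = B 6 j then B 6 i else B 6 z := by
        intro z hz
        rw [hcond, mergeLabels_sem (n := ρ 0) (by simp) z hz]
        simp
      refine ⟨⟨?_, ?_, ?_, fun x => ?_, ?_⟩, fun x y hxy hx hy => ?_, fun _ => ?_⟩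
      · rw [hcond, ← h0]
        exact Keeps.sem_eq (by simp [Keeps, mergeLabels]) _ _ _
      · rw [hcond, ← h3]
        exact Keeps.sem_eq (by simp [Keeps, mergeLabels]) _ _ _
      · rw [hcond, ← h4]
        exact Keeps.sem_eq (by simp [Keeps, mergeLabels]) _ _ _
      · rw [hm x x.2]
        split
        · exact hlt ⟨i, hi⟩
        · exact hlt x
      · exact connected_of_merge (r := H) (L := fun x => B 6 x) (L' := fun x => B' 6 x)
          (fun x y h => ⟨h.1.symm, h.2.1.symm, h.2.2.symm⟩) hr hij (fun z => hm z z.2)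
      · rw [hm x hx, hm y hy, hxy]
      · rw [hm i hi, hm j hj, if_pos rfl]
        split <;> rfl
    · rw [if_neg hij] at hcond
      subst hcond
      exact ⟨⟨h0, h3, h4, hlt, hr⟩, fun x y h _ _ => h, fun h => absurd h hij⟩
  have := sem_forAll (d := 2) (ρ := ρ)
    (S := .forAll <| .ifPos (adjEntry (.var 2) (.var 3)) <|
        .ifPos (eqTest (.get 3 (.var 2)) (.get 3 (.var 3))) <|
        .ifPos (eqTest (pivotBit (.var 2)) (pivotBit (.var 3))) mergeLabels)
    (A := (Stmt.forAll (.store 6 (.var 2) (.var 2))).sem 2 ρ A)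
    (fun i B => Good B ∧ ∀ x y : Fin (ρ 0), (x : ℕ) < i → H x y → B 6 x = B 6 y)
    ⟨hgood, by simp⟩ (by
      intro i B hi ⟨hB, hproc⟩
      have := sem_forAll (d := 3) (ρ := Function.update ρ 2 i)
        (S := .ifPos (adjEntry (.var 2) (.var 3)) <|
          .ifPos (eqTest (.get 3 (.var 2)) (.get 3 (.var 3))) <|
          .ifPos (eqTest (pivotBit (.var 2)) (pivotBit (.var 3))) mergeLabels) (A := B)
        (fun j B => Good B ∧ ∀ x y : Fin (ρ 0), ((x : ℕ) < i ∨ (x : ℕ) = i ∧ (y : ℕ) < j) →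
          H x y → B 6 x = B 6 y)
        ⟨hB, fun x y h => hproc x y (by omega)⟩ (by
          intro j B hj ⟨hB, hproc⟩
          have hj' : j < ρ 0 := by simpa [Function.update_apply] using hj
          obtain ⟨hG, hmono, hnew⟩ := hstep B i j hi hj' hB _ rfl
          refine ⟨hG, fun x y hxy hadj => ?_⟩
          by_cases hold : (x : ℕ) < i ∨ (x : ℕ) = i ∧ (y : ℕ) < j
          · exact hmono _ _ (hproc x y hold hadj) x.2 y.2
          · obtain ⟨h1, h2⟩ : (x : ℕ) = i ∧ (y : ℕ) = j := by omega
            obtain rfl : x = ⟨i, hi⟩ := Fin.ext h1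
            obtain rfl : y = ⟨j, hj'⟩ := Fin.ext h2
            exact hnew hadj)
      refine ⟨this.1, fun x y hx hadj => this.2 x y ?_ hadj⟩
      have hy := y.2
      simp only [Function.update_apply]
      simp
      omega)
  exact ⟨this.1.2.2.2.1, this.1.2.2.2.2, fun x y => this.2 x y x.2⟩

/-- Each label first receives one of its own vertices as the fallback; each link found later
overwrites the entry. Whichever link is written last will do. -/
theorem findPivots_sem {n : ℕ} {G : SimpleGraph (Fin n)} {ρ : ℕ → ℕ} {A : ℕ → ℕ → ℕ}
    (hn : ρ 0 = n) (hA : HoldsGraph G A) {p : Fin n → Fin n} (hp : ∀ w : Fin n, A 4 w = p w)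
    (x : Fin n) :
    (∃ w u : Fin n, G.Adj u w ∧ G.Adj (p w) u ∧ A 3 u = A 3 w ∧ A 6 w = A 6 x ∧
      findPivots.sem 2 ρ A 7 (A 6 x) = u) ∨
    (∃ w : Fin n, A 6 w = A 6 x ∧ findPivots.sem 2 ρ A 7 (A 6 x) = w) ∧
      ∀ w u : Fin n, G.Adj u w → G.Adj (p w) u → A 3 u = A 3 w → A 6 w ≠ A 6 x := by
  subst hn
  let Link : Fin (ρ 0) → Fin (ρ 0) → Prop := fun w u =>
    G.Adj u w ∧ G.Adj (p w) u ∧ A 3 u = A 3 w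
  let Good : (ℕ → ℕ → ℕ) → Prop := fun B => B 0 = A 0 ∧ B 3 = A 3 ∧ B 4 = A 4 ∧ B 6 = A 6
  let Done : (Fin (ρ 0) → Fin (ρ 0) → Prop) → (ℕ → ℕ → ℕ) → Prop := fun P B =>
    ∀ x : Fin (ρ 0), (∃ w u : Fin (ρ 0), Link w u ∧ A 6 w = A 6 x ∧ B 7 (A 6 x) = u) ∨
      (∃ w : Fin (ρ 0), A 6 w = A 6 x ∧ B 7 (A 6 x) = w) ∧
        ∀ w u : Fin (ρ 0), P w u → Link w u → A 6 w ≠ A 6 x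
  have hinit := sem_forAll (S := .store 7 (.get 6 (.var 2)) (.var 2)) (d := 2) (ρ := ρ) (A := A)
      (fun i B => Good B ∧ ∀ x : Fin (ρ 0), (x : ℕ) < i →
        ∃ w : Fin (ρ 0), A 6 w = A 6 x ∧ B 7 (A 6 x) = w) ⟨⟨rfl, rfl, rfl, rfl⟩, by simp⟩ (by
        rintro i B hi ⟨⟨h0, h3, h4, h6⟩, hB⟩
        simp only [Stmt.sem, Expr.eval, Function.update_self]
        refine ⟨⟨?_, ?_, ?_, ?_⟩, fun x hx => ?_⟩
        · simp [h0]
        · simp [h3]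
        · simp [h4]
        · simp [h6]
        · rw [h6]
          by_cases hxi : A 6 x = A 6 i
          · exact ⟨⟨i, hi⟩, hxi.symm, by simp [hxi]⟩
          · obtain ⟨w, hw, hw'⟩ := hB x (by
              have : (x : ℕ) ≠ i := fun h => hxi (by rw [h])
              omega)
            exact ⟨w, hw, by simp [Function.update_of_ne hxi, hw']⟩)
  have hstep : ∀ (B : ℕ → ℕ → ℕ) (i j : ℕ) (hi : i < ρ 0) (hj : j < ρ 0) (P P'), Good B →
      Done P B → (∀ w u, P' w u → P w u ∨ w = ⟨i, hi⟩ ∧ u = ⟨j, hj⟩) → ∀ B',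
      B' = Stmt.sem (.ifPos (adjEntry (.var 3) (.var 2)) <|
        .ifPos (adjEntry (.get 4 (.var 2)) (.var 3)) <|
        .ifPos (eqTest (.get 3 (.var 3)) (.get 3 (.var 2))) <|
        .store 7 (.get 6 (.var 2)) (.var 3)) 4
        (Function.update (Function.update ρ 2 i) 3 j) B → Good B' ∧ Done P' B' := by
    intro B i j hi hj P P' ⟨h0, h3, h4, h6⟩ hB hP B' hB'
    have hcond : B' = open Classical in if Link ⟨i, hi⟩ ⟨j, hj⟩ then
        Function.update B 7 (Function.update (B 7) (A 6 i) j) else B := by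
      rw [hB']
      simp only [Stmt.sem, eqTest_pos, adjEntry, Expr.eval, Function.update_apply]
      simp only [Nat.reduceEqDiff, if_true, if_false, OfNat.zero_ne_ofNat, h0, h3, h4, h6]
      have e1 := (hA ⟨j, hj⟩ ⟨i, hi⟩).1
      have e2 := (hA (p ⟨i, hi⟩) ⟨j, hj⟩).1
      rw [← hp] at e2
      dsimp only at e1 e2
      simp only [Link, ← e1, ← e2]
      split_ifs <;> first | rfl | tauto
    by_cases hij : Link ⟨i, hi⟩ ⟨j, hj⟩
    · rw [if_pos hij] at hcond
      subst hcond
      refine ⟨⟨by simp [h0], by simp [h3], by simp [h4], by simp [h6]⟩, fun x => ?_⟩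
      by_cases hxi : A 6 x = A 6 i
      · exact .inl ⟨_, _, hij, hxi.symm, by simp [hxi]⟩
      · have hval : Function.update B 7 (Function.update (B 7) (A 6 i) j) 7 (A 6 x) =
            B 7 (A 6 x) := by simp [Function.update_of_ne hxi]
        rw [hval]
        refine (hB x).imp id fun h => ⟨h.1, fun w u hwu hl => ?_⟩
        rcases hP w u hwu with hwu | ⟨rfl, rfl⟩
        · exact h.2 w u hwu hl
        · exact fun h => hxi h.symm
    · rw [if_neg hij] at hcond
      subst hcond
      refine ⟨⟨h0, h3, h4, h6⟩, fun x => (hB x).imp id fun h => ⟨h.1, fun w u hwu hl => ?_⟩⟩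
      rcases hP w u hwu with hwu | ⟨rfl, rfl⟩
      · exact h.2 w u hwu hl
      · exact absurd hl hij
  have := sem_forAll (d := 2) (ρ := ρ)
    (S := .forAll <| .ifPos (adjEntry (.var 3) (.var 2)) <|
        .ifPos (adjEntry (.get 4 (.var 2)) (.var 3)) <|
        .ifPos (eqTest (.get 3 (.var 3)) (.get 3 (.var 2))) <|
        .store 7 (.get 6 (.var 2)) (.var 3))
    (A := (Stmt.forAll (.store 7 (.get 6 (.var 2)) (.var 2))).sem 2 ρ A)
    (fun i B => Good B ∧ Done (fun w _ => (w : ℕ) < i) B)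
    ⟨hinit.1, fun x => .inr ⟨hinit.2 x x.2, by simp⟩⟩ (by
      intro i B hi ⟨hB, hproc⟩
      have := sem_forAll (d := 3) (ρ := Function.update ρ 2 i)
        (S := .ifPos (adjEntry (.var 3) (.var 2)) <|
          .ifPos (adjEntry (.get 4 (.var 2)) (.var 3)) <|
          .ifPos (eqTest (.get 3 (.var 3)) (.get 3 (.var 2))) <|
          .store 7 (.get 6 (.var 2)) (.var 3)) (A := B)
        (fun j B => Good B ∧
          Done (fun w u => (w : ℕ) < i ∨ (w : ℕ) = i ∧ (u : ℕ) < j) B)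
        ⟨hB, fun x => (hproc x).imp id fun h => ⟨h.1, fun w u hwu => h.2 w u (by omega)⟩⟩ (by
          intro j B hj ⟨hB, hproc⟩
          have hj' : j < ρ 0 := by simpa [Function.update_apply] using hj
          refine hstep B i j hi hj' _ _ hB hproc (fun w u hwu => ?_) _ rfl
          simp only [Fin.ext_iff]
          omega)
      refine ⟨this.1, fun x => (this.2 x).imp id fun h => ⟨h.1, fun w u hwu => h.2 w u ?_⟩⟩
      have hu := u.2
      simp only [Function.update_apply]
      simp
      omega)
  rcases this.2 x with ⟨w, u, hl, hw, hu⟩ | ⟨h1, h2⟩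
  · exact .inl ⟨w, u, hl.1, hl.2.1, hl.2.2, hw, hu⟩
  · exact .inr ⟨h1, fun w u ha hb hc => h2 w u w.2 ⟨ha, hb, hc⟩⟩

theorem updateKeys_sem {n : ℕ} {ρ : ℕ → ℕ} {A : ℕ → ℕ → ℕ} (hn : ρ 0 = n) (x : ℕ) (hx : x < n) :
    updateKeys.sem 2 ρ A 3 x = A 3 x * n + A 6 x ∧
    updateKeys.sem 2 ρ A 4 x = A 7 (A 6 x) := by
  subst hn
  have := sem_forAll (d := 2) (ρ := ρ) (A := A) (S := .seq
    (.store 3 (.var 2) (.add (.mulSize (.get 3 (.var 2))) (.get 6 (.var 2))))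
    (.store 4 (.var 2) (.get 7 (.get 6 (.var 2)))))
    (fun i B => B 6 = A 6 ∧ B 7 = A 7 ∧ ∀ x, B 3 x = (if x < i then A 3 x * ρ 0 + A 6 x else A 3 x) ∧
      (x < i → B 4 x = A 7 (A 6 x))) (by simp) (by
      rintro i B hi ⟨h6, h7, hB⟩
      simp only [Stmt.sem, Expr.eval, Function.update_apply]
      simp only [Nat.reduceEqDiff, if_true, if_false, OfNat.zero_ne_ofNat, h6, h7, true_and]
      intro x
      by_cases hxi : x = i
      · subst hxi
        simp [(hB x).1]
      · have : x < i + 1 ↔ x < i := by omega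
        simp only [Function.update_of_ne hxi, this]
        simpa [Function.update_apply, hxi] using hB x)
  have hx' := this.2.2 x
  exact ⟨by rw [if_pos hx] at hx'; exact hx'.1, hx'.2 hx⟩

theorem refineCells_sem {n : ℕ} {G : SimpleGraph (Fin n)} {ρ : ℕ → ℕ} {A : ℕ → ℕ → ℕ}
    (hn : ρ 0 = n) (hA : HoldsGraph G A) {p : Fin n → Fin n} (hp : ∀ w : Fin n, A 4 w = p w)
    (hpK : ∀ x y : Fin n, A 3 x = A 3 y → p x = p y) :
    ∃ p' : Fin n → Fin n, (∀ w : Fin n, refineCells.sem 2 ρ A 4 w = p' w) ∧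
      IsRefinementStep G (fun w => A 3 w) (fun w => refineCells.sem 2 ρ A 3 w) p p' := by
  obtain ⟨hL, hconn, hadj⟩ := labelComponents_sem hn hA hp
  have hk : ∀ a ∈ ({0, 3, 4} : Set ℕ), labelComponents.sem 2 ρ A a = A a := by
    rintro a (rfl | rfl | rfl) <;>
      exact Keeps.sem_eq (by simp [labelComponents, mergeLabels, Keeps]) _ _ _
  set B := labelComponents.sem 2 ρ A with hB
  have hfind := findPivots_sem (ρ := ρ) (A := B) (p := p) (G := G) hn
    (by rw [HoldsGraph, hk 0 (by simp)]; exact hA) (by rw [hk 4 (by simp)]; exact hp)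
  have hk' : ∀ a ∈ ({3, 6} : Set ℕ), findPivots.sem 2 ρ B a = B a := by
    rintro a (rfl | rfl) <;> exact Keeps.sem_eq (by simp [findPivots, Keeps]) _ _ _
  have hupd := updateKeys_sem (ρ := ρ) (A := findPivots.sem 2 ρ B) hn
  rw [hk' 3 (by simp), hk' 6 (by simp), hk 3 (by simp)] at hupd
  rw [hk 3 (by simp)] at hfind
  set C := findPivots.sem 2 ρ B with hC
  have hD : refineCells.sem 2 ρ A = updateKeys.sem 2 ρ C := rfl
  have hex : ∀ x : Fin n, ∃ w : Fin n, C 7 (B 6 x) = w := by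
    intro x
    rcases hfind x with ⟨w, u, -, -, -, -, h⟩ | ⟨⟨w, -, h⟩, -⟩
    · exact ⟨u, h⟩
    · exact ⟨w, h⟩
  choose p' hp' using hex
  -- The new key is `A 3 x * n + B 6 x` with label below `n`, so it determines the label modulo `n`.
  -- Conversely, vertices with equal labels are connected inside an old cell and share the old key.
  have hkey : ∀ x y : Fin n, refineCells.sem 2 ρ A 3 x = refineCells.sem 2 ρ A 3 y ↔
      B 6 x = B 6 y := by
    intro x y
    rw [hD, (hupd x x.2).1, (hupd y y.2).1]
    constructor
    · intro h
      have := congrArg (· % n) h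
      simpa [Nat.mod_eq_of_lt (hL x), Nat.mod_eq_of_lt (hL y), Nat.mul_add_mod'] using this
    · intro h
      have hr := hconn x y h
      have : A 3 x = A 3 y := by
        clear h
        induction hr with
        | refl => rfl
        | tail _ hbc ih => exact ih.trans hbc.2.1
      rw [h, this]
  refine ⟨p', fun w => ?_, ?_, ?_, ?_, ?_, ?_⟩
  · rw [hD, (hupd w w.2).2, hp']
  · intro x y hxy
    rw [hD, (hupd x x.2).1, (hupd y y.2).1]
    calc A 3 x * n + B 6 x < A 3 x * n + n := Nat.add_lt_add_left (hL x) _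
      _ = (A 3 x + 1) * n := by ring
      _ ≤ A 3 y * n := Nat.mul_le_mul_right _ hxy
      _ ≤ _ := Nat.le_add_right _ _
  · intro x y h1 h2 h3
    exact (hkey x y).2 (hadj x y ⟨h1, h2, h3⟩)
  · exact fun x y h => hconn x y ((hkey x y).1 h)
  · exact fun x y h => Fin.ext (by rw [← hp', ← hp', (hkey x y).1 h])
  · intro x
    have hcell : ∀ w : Fin n, B 6 w = B 6 x → A 3 w = A 3 x := by
      intro w hw
      have hr := hconn w x hw
      clear hw
      induction hr with
      | refl => rfl
      | tail _ hbc ih => exact ih.trans hbc.2.1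
    rcases hfind x with ⟨w, u, h1, h2, h3, h4, h5⟩ | ⟨⟨w, h1, h2⟩, h3⟩
    · have hu : p' x = u := Fin.ext ((hp' x).symm.trans h5)
      rw [hu]
      refine .inl ⟨h3.trans (hcell w h4), ?_, w, (hkey w x).2 h4, h1⟩
      rwa [← hpK w x (hcell w h4)]
    · have hw : p' x = w := Fin.ext ((hp' x).symm.trans h2)
      rw [hw]
      refine .inr ⟨?_, (hkey w x).2 h1⟩
      rintro u ⟨h4, h5, y, h6, h7⟩
      have hy := (hkey y x).1 h6
      refine h3 y u h7 ?_ (h4.trans (hcell y hy).symm) hy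
      rwa [hpK y x (hcell y hy)]

end RAM

/-! ### From the keys to the output -/

namespace RAM

open Stmt

/-- `S` is repeated `D` times. -/
def Stmt.repeat (S : Stmt) : ℕ → Stmt
  | 0 => .skip
  | D + 1 => .seq (S.repeat D) S

/-- Compute the rank of each vertex (array `5`) in the order given by the keys. -/
def computeRanks : Stmt :=
  .forAll <| .forAll <| .ifPos (.sub (.get 3 (.var 2)) (.get 3 (.var 3))) <|
    .store 5 (.var 2) (.add (.get 5 (.var 2)) (.lit 1))

/-- Write the list of the leaves of the caterpillar. -/
def writeLeaves : Stmt :=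
  let a : Expr := .add (.add (.get 5 (.var 2)) (.get 5 (.var 2))) (.lit 1)
  .forAll <| .store 2 (.var 2) (.sub a (.sub a (.sub (.add (.var 0) (.var 0)) (.lit 2))))

/-- The number of vertices of the caterpillar. -/
def treeSize : Expr := .sub (.add (.var 0) (.var 0)) (.lit 1)

/-- Write a one in row `i` and column `j` of the adjacency matrix of the caterpillar. -/
def writeEntry (i j : Expr) : Stmt :=
  .store 1 (.add (.sub (.mulSize (.add i i)) i) j) (.lit 1)

/-- Write the adjacency matrix of the caterpillar. -/
def writeTree : Stmt :=
  .forAll <| .ifPos (.sub (.sub (.var 0) (.lit 1)) (.var 2)) <| .bind (.add (.var 2) (.var 2)) <|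
    .seq (.seq (writeEntry (.var 3) (.add (.var 3) (.lit 1)))
        (writeEntry (.add (.var 3) (.lit 1)) (.var 3)))
      (.seq (writeEntry (.var 3) (.add (.var 3) (.lit 2)))
        (writeEntry (.add (.var 3) (.lit 2)) (.var 3)))

/-- The algorithm, up to the output of the size of the tree. -/
def decompose (D : ℕ) : Stmt :=
  .seq (refineCells.repeat D) (.seq computeRanks (.seq writeLeaves writeTree))

/-- The algorithm. -/
def decomposeProgram (D : ℕ) : Program :=
  .seq ((decompose D).compile 2) (.seq (treeSize.compile 2) (.seq (.const 1 0) (.add 1 1 2)))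

theorem computeRanks_sem {n : ℕ} {ρ : ℕ → ℕ} {A : ℕ → ℕ → ℕ} (hn : ρ 0 = n) (h5 : A 5 = 0)
    (x : ℕ) (hx : x < n) :
    computeRanks.sem 2 ρ A 5 x = ((Finset.range n).filter fun y => A 3 y < A 3 x).card := by
  subst hn
  have := sem_forAll (d := 2) (ρ := ρ) (A := A)
    (S := .forAll <| .ifPos (.sub (.get 3 (.var 2)) (.get 3 (.var 3))) <|
      .store 5 (.var 2) (.add (.get 5 (.var 2)) (.lit 1)))
    (fun i B => B 3 = A 3 ∧ ∀ x, B 5 x =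
      if x < i then ((Finset.range (ρ 0)).filter fun y => A 3 y < A 3 x).card else 0)
    (by simp [h5]) (by
      rintro i B hi ⟨h3, hB⟩
      have := sem_forAll (d := 3) (ρ := Function.update ρ 2 i) (A := B)
        (S := .ifPos (.sub (.get 3 (.var 2)) (.get 3 (.var 3))) <|
          .store 5 (.var 2) (.add (.get 5 (.var 2)) (.lit 1)))
        (fun j C => C 3 = A 3 ∧
          (C 5 i = ((Finset.range j).filter fun y => A 3 y < A 3 i).card) ∧
          ∀ x, x ≠ i → C 5 x = B 5 x)
        (by simp [h3, hB]) (by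
          rintro j C hj ⟨h3, hi', hC⟩
          have hcond : 0 < (Expr.sub (.get 3 (.var 2)) (.get 3 (.var 3))).eval
              (Function.update (Function.update ρ 2 i) 3 j) C ↔ A 3 j < A 3 i := by
            simp [Expr.eval, h3]
          rw [Finset.range_add_one, Finset.filter_insert, Stmt.sem]
          by_cases hlt : A 3 j < A 3 i
          · rw [if_pos (hcond.2 hlt), if_pos hlt, Finset.card_insert_of_notMem (by simp)]
            simp only [Stmt.sem, Expr.eval, Function.update_self, ne_eq, Nat.reduceEqDiff,
              not_false_eq_true, Function.update_of_ne, h3, hi', true_and]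
            intro x hx
            rw [Function.update_of_ne hx, hC x hx]
          · rw [if_neg (mt hcond.1 hlt), if_neg hlt]
            exact ⟨h3, hi', hC⟩)
      refine ⟨this.1, fun x => ?_⟩
      by_cases hxi : x = i
      · subst hxi
        rw [if_pos x.lt_succ_self]
        simpa using this.2.1
      · have h : x < i + 1 ↔ x < i := by omega
        rw [this.2.2 x hxi, hB x, if_congr h rfl rfl])
  rw [computeRanks, this.2 x, if_pos hx]

theorem writeLeaves_sem {n : ℕ} {ρ : ℕ → ℕ} {A : ℕ → ℕ → ℕ} (hn : ρ 0 = n)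
    (x : ℕ) (hx : x < n) :
    writeLeaves.sem 2 ρ A 2 x = min (2 * A 5 x + 1) (2 * n - 2) := by
  subst hn
  let a : Expr := .add (.add (.get 5 (.var 2)) (.get 5 (.var 2))) (.lit 1)
  have := sem_forAll (d := 2) (ρ := ρ) (A := A)
    (S := .store 2 (.var 2) (.sub a (.sub a (.sub (.add (.var 0) (.var 0)) (.lit 2)))))
    (fun i B => B 5 = A 5 ∧ ∀ x < i, B 2 x = min (2 * A 5 x + 1) (2 * ρ 0 - 2))
    (by simp) (by
      rintro i B hi ⟨h5, hB⟩
      simp only [Stmt.sem, Expr.eval, Function.update_apply, a]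
      simp only [Nat.reduceEqDiff, if_true, if_false, OfNat.zero_ne_ofNat, h5, true_and]
      intro x hx
      by_cases hxi : x = i
      · subst hxi
        simp only [Function.update_self]
        omega
      · rw [Function.update_of_ne hxi]
        exact hB x (by omega))
  exact this.2 x hx

theorem index_inj {m i j i' j' : ℕ} (hj : j < m) (hj' : j' < m) :
    i * m + j = i' * m + j' ↔ i = i' ∧ j = j' := by
  refine ⟨fun h => ?_, by rintro ⟨rfl, rfl⟩; rfl⟩
  have h1 := congrArg (· % m) h
  have h2 := congrArg (· / m) h
  have hm : 0 < m := by omega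
  simp only [Nat.mul_add_mod', Nat.mod_eq_of_lt hj, Nat.mod_eq_of_lt hj'] at h1
  simp only [mul_comm _ m, Nat.mul_add_div hm, Nat.div_eq_of_lt hj, Nat.div_eq_of_lt hj',
    add_zero] at h2
  exact ⟨h2, h1⟩

theorem writeTree_sem {n : ℕ} {ρ : ℕ → ℕ} {A : ℕ → ℕ → ℕ} (hn : ρ 0 = n) (h1 : A 1 = 0)
    {i j : ℕ} (hj : j < 2 * n - 1) (hi : i < 2 * n - 1) :
    writeTree.sem 2 ρ A 1 (i * (2 * n - 1) + j) =
      if (i % 2 = 0 ∧ (j = i + 1 ∨ j = i + 2)) ∨ (j % 2 = 0 ∧ (i = j + 1 ∨ i = j + 2))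
      then 1 else 0 := by
  subst hn
  -- Rows of the tree's matrix have length `2 * n - 1`, but only multiplication by `n` is at hand.
  have hmul : ∀ e : ℕ, (e + e) * ρ 0 - e = e * (2 * ρ 0 - 1) := by
    intro e
    rw [Nat.mul_sub, mul_one, ← mul_two, mul_assoc]
  have := sem_forAll (d := 2) (ρ := ρ) (A := A)
    (S := .ifPos (.sub (.sub (.var 0) (.lit 1)) (.var 2)) <| .bind (.add (.var 2) (.var 2)) <|
      .seq (.seq (writeEntry (.var 3) (.add (.var 3) (.lit 1)))
          (writeEntry (.add (.var 3) (.lit 1)) (.var 3)))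
        (.seq (writeEntry (.var 3) (.add (.var 3) (.lit 2)))
          (writeEntry (.add (.var 3) (.lit 2)) (.var 3))))
    (fun k B => ∀ i j, i < 2 * ρ 0 - 1 → j < 2 * ρ 0 - 1 → B 1 (i * (2 * ρ 0 - 1) + j) =
      if (i < 2 * k ∧ i % 2 = 0 ∧ (j = i + 1 ∨ j = i + 2)) ∨
        (j < 2 * k ∧ j % 2 = 0 ∧ (i = j + 1 ∨ i = j + 2)) then 1 else 0)
    (by simp [h1]) (by
      intro k B hk hB i j hi hj
      have hcond : 0 < (Expr.sub (.sub (.var 0) (.lit 1)) (.var 2)).eval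
          (Function.update ρ 2 k) B ↔ k + 1 < ρ 0 := by
        simp only [Expr.eval, Function.update_self, ne_eq, OfNat.zero_ne_ofNat, not_false_eq_true,
          Function.update_of_ne]
        omega
      rw [Stmt.sem]
      by_cases hlt : k + 1 < ρ 0
      · rw [if_pos (hcond.2 hlt)]
        simp only [Stmt.sem, Expr.eval, writeEntry, Function.update_apply]
        simp only [Nat.reduceEqDiff, if_true, if_false, OfNat.zero_ne_ofNat, hmul]
        simp only [Function.update_apply]
        simp only [index_inj hj (show k + k < 2 * ρ 0 - 1 by omega),
          index_inj hj (show k + k + 1 < 2 * ρ 0 - 1 by omega),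
          index_inj hj (show k + k + 2 < 2 * ρ 0 - 1 by omega), hB i j hi hj, ← ite_or]
        exact if_congr (by omega) rfl rfl
      -- The last spine vertex has no successors within range, so nothing needs to be written.
      · rw [if_neg (mt hcond.1 hlt), hB i j hi hj]
        exact if_congr (by omega) rfl rfl)
  rw [writeTree, this i j hi hj]
  exact if_congr (by omega) rfl rfl

theorem refineCells_keeps {a : ℕ} (ha : a ∈ ({0, 1, 2, 5} : Set ℕ)) (D d : ℕ) (ρ : ℕ → ℕ)
    (A : ℕ → ℕ → ℕ) : (refineCells.repeat D).sem d ρ A a = A a := by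
  have h : refineCells.Keeps a := by
    rcases ha with rfl | rfl | rfl | rfl <;>
      simp [refineCells, labelComponents, mergeLabels, findPivots, updateKeys, Keeps]
  refine Keeps.sem_eq ?_ _ _ _
  induction D with
  | zero => trivial
  | succ D ih => exact ⟨ih, h⟩

theorem HoldsGraph.inputState {n : ℕ} (G : SimpleGraph (Fin n)) :
    HoldsGraph G (inputState G).arr := by
  intro u w
  have : (∃ i j : Fin n, (u * n + w : ℕ) = i * n + j ∧ G.Adj i j) ↔ G.Adj u w := by
    constructor
    · rintro ⟨i, j, hij, hadj⟩
      obtain ⟨h1, h2⟩ := (index_inj w.2 j.2).1 hij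
      rwa [Fin.ext h1, Fin.ext h2]
    · exact fun h => ⟨u, w, rfl, h⟩
  simp only [RAM.inputState]
  split_ifs with h
  · simpa using this.1 h.2
  · simpa using fun hadj => h ⟨rfl, this.2 hadj⟩

/-- The keys computed by the algorithm form a refinement sequence. -/
theorem exists_isRefinement {n : ℕ} (hn : 0 < n) (G : SimpleGraph (Fin n)) {ρ : ℕ → ℕ}
    (hρ : ρ 0 = n) : ∃ p, IsRefinement G
      (fun i (w : Fin n) => (refineCells.repeat i).sem 2 ρ (inputState G).arr 3 w) p := by
  set A : ℕ → ℕ → ℕ → ℕ := fun i => (refineCells.repeat i).sem 2 ρ (inputState G).arr with hA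
  have hG : ∀ i, HoldsGraph G (A i) := by
    intro i
    rw [HoldsGraph, hA]
    dsimp only
    rw [refineCells_keeps (by simp)]
    exact HoldsGraph.inputState G
  have hp : ∀ i, ∃ p : Fin n → Fin n, (∀ w : Fin n, A i 4 w = p w) ∧
      ∀ x y : Fin n, A i 3 x = A i 3 y → p x = p y := by
    intro i
    induction i with
    -- All arrays but the input start at zero: there is one cell, with vertex `0` as its pivot.
    | zero => exact ⟨fun _ => ⟨0, hn⟩, fun w => by simp [hA, Stmt.repeat, Stmt.sem, inputState],
        fun _ _ _ => rfl⟩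
    | succ i ih =>
      obtain ⟨p, h1, h2⟩ := ih
      obtain ⟨p', h3, h4⟩ := refineCells_sem hρ (hG i) h1 h2
      exact ⟨p', h3, h4.pivot_eq⟩
  choose p hp hpK using hp
  refine ⟨p, fun x y => by simp [Stmt.repeat, Stmt.sem, inputState],
    fun x y => hpK 0 x y (by simp [hA, Stmt.repeat, Stmt.sem, inputState]), fun i => ?_⟩
  obtain ⟨p', h3, h4⟩ := refineCells_sem hρ (hG i) (hp i) (hpK i)
  have : p (i + 1) = p' := funext fun w => Fin.ext ((hp (i + 1) w).symm.trans (h3 w))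
  rw [this]
  exact h4

theorem decompose_scoped (D : ℕ) : (decompose D).Scoped 2 := by
  have h : refineCells.Scoped 2 := by
    simp [refineCells, labelComponents, mergeLabels, findPivots, updateKeys, Stmt.Scoped,
      Expr.Scoped, adjEntry, eqTest, pivotBit]
  refine ⟨?_, by simp [computeRanks, writeLeaves, writeTree, writeEntry, Stmt.Scoped, Expr.Scoped]⟩
  induction D with
  | zero => trivial
  | succ D ih => exact ⟨ih, h⟩

theorem decomposeProgram_spec (D : ℕ) {n : ℕ} (G : SimpleGraph (Fin n)) :
    HaltsWithin (decomposeProgram D) (inputState G)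
      (((decompose D).cost + (treeSize.cost + (1 + 1))).eval n) fun τ =>
        τ.arr = (decompose D).sem 2 (inputState G).reg (inputState G).arr ∧
        τ.reg 1 = 2 * n - 1 := by
  simp only [Polynomial.eval_add, Polynomial.eval_one]
  have h0 : (inputState G).reg 0 = n := rfl
  have h1 := (decompose D).compile_spec (inputState G) two_pos (decompose_scoped D)
    (fun x _ => rfl)
  rw [h0] at h1
  refine h1.seq ?_
  rintro τ ⟨hA, hr⟩
  -- The code uses scratch registers from `2` on; register `0` keeps the input size and register `1`
  -- is left for the output.
  have h2 := treeSize.compile_spec (d := 2) τ two_pos (by simp [treeSize, Expr.Scoped])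
  rw [hr 0 two_pos, h0] at h2
  refine h2.seq ?_
  rintro υ ⟨hυ, hv⟩
  refine HaltsWithin.seq (b := 1) (b' := 1) (.const rfl) ?_
  rintro υ' rfl
  refine .add ⟨hυ.1.trans hA, ?_⟩
  simp [State.setReg_reg, hv, treeSize, Expr.eval, hr 0 two_pos, h0, two_mul]

/-- If the keys after `D` steps are injective, then the algorithm outputs a linear branch
decomposition along their order. -/
theorem decomposeProgram_outputs (D : ℕ) {n : ℕ} (hn : 0 < n) (G : SimpleGraph (Fin n))
    {κ : Fin n → ℕ}
    (hκ : κ = fun w : Fin n => (refineCells.repeat D).sem 2 (inputState G).reg (inputState G).arr 3 w)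
    (hinj : Function.Injective κ) :
    ∃ e : Fin n ≃ Fin n, (∀ x y, e x < e y → κ x < κ y) ∧
      HaltsWithin (decomposeProgram D) (inputState G)
        (((decompose D).cost + (treeSize.cost + (1 + 1))).eval n)
        fun τ => Outputs τ (linearDecomposition hn e) := by
  set A := (refineCells.repeat D).sem 2 (inputState G).reg (inputState G).arr with hA
  have hrank := computeRanks_sem (A := A) (ρ := (inputState G).reg) (n := n) rfl (by
    rw [hA, refineCells_keeps (by simp)]
    rfl)
  have hlt : ∀ x : Fin n, ((Finset.range n).filter fun y => A 3 y < A 3 x).card < n := by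
    intro x
    refine lt_of_lt_of_eq (Finset.card_lt_card ?_) (Finset.card_range n)
    rw [Finset.ssubset_iff_of_subset (Finset.filter_subset _ _)]
    exact ⟨x, by simp, by simp⟩
  have hmono : ∀ x y : Fin n, κ x ≤ κ y → ((Finset.range n).filter fun z => A 3 z < A 3 x).card ≤
      ((Finset.range n).filter fun z => A 3 z < A 3 y).card := by
    intro x y hxy
    rw [hκ] at hxy
    exact Finset.card_le_card (Finset.monotone_filter_right _ fun z _ hz => lt_of_lt_of_le hz hxy)
  have hstrict : ∀ x y : Fin n, κ x < κ y → ((Finset.range n).filter fun z => A 3 z < A 3 x).card <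
      ((Finset.range n).filter fun z => A 3 z < A 3 y).card := by
    intro x y hxy
    refine Finset.card_lt_card ?_
    rw [hκ] at hxy
    rw [Finset.ssubset_iff_of_subset
      (Finset.monotone_filter_right _ fun z _ hz => lt_trans hz hxy)]
    exact ⟨x, by simpa using hxy, by simp⟩
  -- With injective keys, the number of smaller keys is a bijective rank.
  let f : Fin n → Fin n := fun x => ⟨_, hlt x⟩
  have hf : Function.Injective f := by
    intro x y hxy
    have hxy' := congrArg Fin.val hxy
    rcases lt_trichotomy (κ x) (κ y) with h | h | h
    · exact absurd hxy' (hstrict x y h).ne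
    · exact hinj h
    · exact absurd hxy' (hstrict y x h).ne'
  refine ⟨Equiv.ofBijective f (Finite.injective_iff_bijective.1 hf), fun x y hxy => ?_,
    (decomposeProgram_spec D G).mono le_rfl ?_⟩
  · by_contra! h
    exact absurd hxy (not_lt.2 (hmono y x h))
  · rintro τ ⟨hτ, hsize⟩
    have hτ' : τ.arr = writeTree.sem 2 (inputState G).reg (writeLeaves.sem 2 (inputState G).reg
      (computeRanks.sem 2 (inputState G).reg A)) := hτ
    refine ⟨hsize, fun i j => ?_, fun v => ?_⟩
    · rw [hτ']
      have := writeTree_sem (n := n) (ρ := (inputState G).reg) (A := writeLeaves.sem 2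
        (inputState G).reg (computeRanks.sem 2 (inputState G).reg A)) rfl (by
          rw [Keeps.sem_eq (by simp [writeLeaves, Keeps]),
            Keeps.sem_eq (by simp [computeRanks, Keeps]), hA, refineCells_keeps (by simp)]
          rfl) j.2 i.2
      refine this.trans ?_
      congr
    · rw [hτ', Keeps.sem_eq (by simp [writeTree, writeEntry, Keeps]),
        writeLeaves_sem (n := n) rfl v v.2, hrank v v.2, linearDecomposition_leaf]
      rfl

end RAM

/-! ### Conclusion -/

theorem IsFreeOf.of_iso {V : Type u} {W : Type*} {G : SimpleGraph V} {H : SimpleGraph W}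
    {r s t : ℕ} (h : IsFreeOf r s t G) (φ : H ≃g G) : IsFreeOf r s t H :=
  ⟨fun h' => h.1 (h'.trans ⟨φ.toEmbedding⟩), fun h' => h.2.1 (h'.trans ⟨φ.toEmbedding⟩),
    fun h' => h.2.2 (h'.trans ⟨φ.toEmbedding⟩)⟩

/-- The linear orders computed by the algorithm have cuts with bounded induced matchings. -/
theorem exists_bound_decomposeProgram (r s t : ℕ) : ∃ c : ℕ, 1 ≤ c ∧
    ∀ (n : ℕ) (hn : 0 < n) (G : SimpleGraph (Fin n)), IsFreeOf r s t G →
      ∃ e : Fin n ≃ Fin n,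
        (∀ (θ m : ℕ) (a b : Fin m → Fin n), (∀ i, (e (a i) : ℕ) ≤ θ) →
          (∀ i, θ < (e (b i) : ℕ)) → (∀ i j, G.Adj (a i) (b j) ↔ i = j) → m ≤ c) ∧
        RAM.HaltsWithin (RAM.decomposeProgram (r * t + 1)) (RAM.inputState G)
          (((RAM.decompose (r * t + 1)).cost + (RAM.treeSize.cost + (1 + 1))).eval n)
          fun τ => RAM.Outputs τ (linearDecomposition hn e) := by
  obtain ⟨c, hc⟩ := IsRefinement.exists_cut_bound.{0} r s (r * t + 1)
  -- One is added to have a bound of at least one, as the pendant edges of the caterpillar require.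
  refine ⟨c + 1, by omega, fun n hn G ⟨hr, hs, ht⟩ => ?_⟩
  obtain ⟨p, hp⟩ := RAM.exists_isRefinement hn G (ρ := (RAM.inputState G).reg) rfl
  obtain ⟨e, he, hP⟩ := RAM.decomposeProgram_outputs (r * t + 1) hn G rfl (hp.injective hr ht)
  refine ⟨e, fun θ m a b ha hb hab => (hc _ G _ p hp hr hs m a b (fun i j => ?_) hab).trans
    c.le_succ, hP⟩
  exact he _ _ ((ha i).trans_lt (hb j))

theorem theorem2p6 (r s t : ℕ) (hr : 1 ≤ r) (hs : 1 ≤ s) (ht : 1 ≤ t) :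
    BoundedMimWidth.{u} (fun _ G => IsFreeOf r s t G) ∧
      QuicklyComputableMimWidth (fun _ G => IsFreeOf r s t G) := by
  obtain ⟨c, hc, h⟩ := exists_bound_decomposeProgram r s t
  refine ⟨⟨c, fun V _ _ G hG => ?_⟩, c, RAM.decomposeProgram (r * t + 1),
    (RAM.decompose (r * t + 1)).cost + (RAM.treeSize.cost + (1 + 1)), fun n G hn hG => ?_⟩
  -- For boundedness on an arbitrary vertex type, the graph is copied to `Fin (Nat.card V)` and the
  -- order found there is pulled back.
  · let φ : V ≃ Fin (Nat.card V) := Finite.equivFin V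
    let ψ : G.comap φ.symm ≃g G := ⟨φ.symm, Iff.rfl⟩
    obtain ⟨e, he, -⟩ := h (Nat.card V) Nat.card_pos (G.comap φ.symm) (hG.of_iso ψ)
    refine (iInf_le _ (linearDecomposition Nat.card_pos (φ.trans e))).trans
      (linearDecomposition_mimw_le _ _ hc fun θ m a b ha hb hab =>
        he θ m (φ ∘ a) (φ ∘ b) ha hb fun i j => ?_)
    simp [hab]
  · obtain ⟨e, he, τ, k, hrun, hk, hout⟩ := h n hn G hG
    exact ⟨τ, k, _, hrun, hk, hout, linearDecomposition_mimw_le _ _ hc he⟩
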